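/- Let $d,k\ge 1$ and let $\mathbb S^d$ be the unit sphere of $\mathbb R^{d+1}$, with uniform probability distribution $U^d$. Let $\Phi:\mathbb R^{d+1}\to\mathbb R^k$ and $V:\mathbb R^{d+1}\to\mathbb R$ be differentiable and (positively) $2$-homogeneous, i.e. $\Phi(c\theta)=c^2\Phi(\theta)$ and $V(c\theta)=c^2V(\theta)$ for all $c>0$, and let $R:\mathbb R^k\to\mathbb R$ be twice differentiable. Assume: 1. $R$ is convex and nonnegative, $\|\nabla R\|_2\le M_R$ and $\|\nabla^2R\|_{op}\le C_R$ everywhere; 2. $\|\Phi(\theta)\|_2\le B_\Phi$ and $|\Phi_i(\theta)-\Phi_i(\theta')|\le M_\Phi\|\theta-\theta'\|_2$ for all $\theta,\theta'\in\mathbb S^d$ and all $i$; 3. $0<b_V\le V(\theta)\le B_V$ and $\|\nabla V(\theta)\|_2\le M_V$ for all $\theta\in\mathbb S^d$; 4. $\nabla\Phi_i$ ($1\le i\le k$) is $C_\Phi$-Lipschitz and $\nabla V$ is $C_V$-Lipschitz on $\mathbb R^{d+1}$. For a probability measure $\rho$ on $\mathbb R^{d+1}$ with finite second moment put $$L[\rho]=R\Big(\int\Phi\,d\rho\Big)+\int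 V\,d\rho,\qquad L'[\rho](\theta)=\Big\langle\nabla R\Big(\int\Phi\,d\rho\Big),\Phi(\theta)\Big\rangle+V(\theta),\qquad v[\rho]=-\nabla_\theta L'[\rho],$$ and let $L^\star=\inf_\rho L[\rho]$ over all such $\rho$ (for other distributions $\int V\,d\rho=+\infty$). Let $\rho_0$ be a probability measure with finite second moment. For a step size $\eta$ and a noise level $\sigma$ consider the discrete-time version of $\frac{d}{dt}\rho_t=-\sigma\rho_t+\sigma U^d-\nabla\cdot(v[\rho_t]\rho_t)$ in which, at each step, every particle $\theta$ moves to $\theta+\eta v[\rho_t](\theta)$ (the transport term) and a fraction $\eta\sigma$ of the mass is re-initialised from $U^d$: $$\rho_{t+1}=(1-\eta\sigma)\,\big(\mathrm{id}+\eta\,v[\rho_t]\big)_{\#}\rho_t+\eta\sigma\,U^d ,\qquad t=0,1,2,\dots$$ Then there are polynomials $p_\sigma,p_\eta,p_t$ with real coefficients, independent of all the data above, such that the following holds for all such data and every $0<\varepsilon\le\frac12$. Let $X=(k,M_V,M_R,b_V^{-1},B_V,C_R,B_\Phi,C_\Phi,C_V,L[\rho_0])$ and $$\sigma=\exp\!\big(-d\log(1/\varepsilon)\,p_\sigma(X)\big),\qquad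 \eta=\frac1{p_\eta(X)},\qquad t_\varepsilon=\frac{d^2}{\varepsilon^4}\,p_t(X).$$ Then $p_\sigma(X)>0$, $0<\eta\le1$, every $\rho_t$ is a probability measure with finite second moment, and $$\min_{0\le t\le t_\varepsilon}L[\rho_t]-L^\star\le\varepsilon ,$$ the minimum being over integers $t$. No existence of a solution of the continuous-time dynamics is assumed. -/

import Mathlib

open MeasureTheory Set

noncomputable section

namespace PerturbedWGF

/-- Euclidean space `ℝⁿ` with the `ℓ₂` norm. -/
abbrev E (n : ℕ) : Type := EuclideanSpace ℝ (Fin n)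

/-- Positive `2`-homogeneity: `f (c θ) = c² f θ` for all `c > 0`. -/
def IsTwoHomogeneous {n : ℕ} {F : Type*} [SMul ℝ F] (f : E n → F) : Prop :=
  ∀ c : ℝ, 0 < c → ∀ θ : E n, f (c • θ) = c ^ 2 • f θ

/-- `R` is convex, nonnegative, `M_R`-Lipschitz in the sense `‖∇R‖₂ ≤ M_R`, and twice
differentiable with `‖∇²R‖_op ≤ C_R` (the Hessian is the derivative of the gradient). -/
structure RegularLoss {k : ℕ} (R : E k → ℝ) (M_R C_R : ℝ) : Prop where
  convex : ConvexOn ℝ univ R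
  nonneg : ∀ x, 0 ≤ R x
  differentiable : Differentiable ℝ R
  norm_gradient_le : ∀ x, ‖gradient R x‖ ≤ M_R
  differentiable_gradient : Differentiable ℝ (gradient R)
  norm_hessian_le : ∀ x, ‖fderiv ℝ (gradient R) x‖ ≤ C_R

/-- `Φ` is differentiable, and bounded and coordinatewise Lipschitz on the unit sphere. -/
structure RegularFeature {n k : ℕ} (Φ : E n → E k) (B_Φ M_Φ : ℝ) : Prop where
  differentiable : Differentiable ℝ Φ
  norm_le : ∀ θ : E n, ‖θ‖ = 1 → ‖Φ θ‖ ≤ B_Φ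
  lipschitz : ∀ i : Fin k, ∀ θ θ' : E n, ‖θ‖ = 1 → ‖θ'‖ = 1 →
    |Φ θ i - Φ θ' i| ≤ M_Φ * ‖θ - θ'‖

/-- `V` is differentiable, bounded above and below by positive constants on the unit sphere,
with gradient bounded on the unit sphere. -/
structure RegularPotential {n : ℕ} (V : E n → ℝ) (b_V B_V M_V : ℝ) : Prop where
  differentiable : Differentiable ℝ V
  lower_pos : 0 < b_V
  lower_le : ∀ θ : E n, ‖θ‖ = 1 → b_V ≤ V θ
  le_upper : ∀ θ : E n, ‖θ‖ = 1 → V θ ≤ B_V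
  norm_gradient_le : ∀ θ : E n, ‖θ‖ = 1 → ‖gradient V θ‖ ≤ M_V

/-- The gradient of `f` is `C`-Lipschitz on the whole space. -/
def GradientLipschitz {n : ℕ} (f : E n → ℝ) (C : ℝ) : Prop :=
  ∀ θ θ' : E n, ‖gradient f θ - gradient f θ'‖ ≤ C * ‖θ - θ'‖

/-- Probability measures with finite second moment. For `2`-homogeneous `V ≥ b_V > 0` on the
sphere these are exactly the distributions with `∫ V dρ < ∞`, i.e. of finite objective. -/
structure IsAdmissible {n : ℕ} (ρ : Measure (E n)) : Prop where
  prob : IsProbabilityMeasure ρ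
  secondMoment : Integrable (fun θ : E n => ‖θ‖ ^ 2) ρ

/-- The objective `L[ρ] = R(∫ Φ dρ) + ∫ V dρ`. -/
def objective {n k : ℕ} (R : E k → ℝ) (Φ : E n → E k) (V : E n → ℝ) (ρ : Measure (E n)) : ℝ :=
  R (∫ θ, Φ θ ∂ρ) + ∫ θ, V θ ∂ρ

/-- `L⋆ = inf_ρ L[ρ]`. -/
def optimalValue {n k : ℕ} (R : E k → ℝ) (Φ : E n → E k) (V : E n → ℝ) : ℝ :=
  ⨅ ρ : {ρ : Measure (E n) // IsAdmissible ρ}, objective R Φ V ρ.1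

/-- `L'[ρ](θ) = ⟨∇R(∫ Φ dρ), Φ(θ)⟩ + V(θ)`. -/
def firstVariation {n k : ℕ} (R : E k → ℝ) (Φ : E n → E k) (V : E n → ℝ) (ρ : Measure (E n))
    (θ : E n) : ℝ :=
  inner ℝ (gradient R (∫ θ', Φ θ' ∂ρ)) (Φ θ) + V θ

/-- The velocity field `v[ρ](θ) = -∇_θ L'[ρ](θ)`. -/
def velocity {n k : ℕ} (R : E k → ℝ) (Φ : E n → E k) (V : E n → ℝ) (ρ : Measure (E n))
    (θ : E n) : E n :=
  - gradient (firstVariation R Φ V ρ) θ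

/-- The uniform probability distribution on the unit sphere of `ℝⁿ`, as a measure on `ℝⁿ`
(`U^d` is the case `n = d + 1`). -/
def uniformSphere (n : ℕ) : Measure (E n) :=
  (((volume : Measure (E n)).toSphere univ)⁻¹ • (volume : Measure (E n)).toSphere).map
    Subtype.val

/-- One discrete-time update of the perturbed dynamics with step size `η` and noise level `σ`:
`ρ⁺ = (1 - ησ) (id + η v[ρ])_# ρ + ησ U^d`.
The transport part `-η ∇·(v[ρ] ρ)` moves every particle `θ` to `θ + η v[ρ](θ)`, and a fraction
`ησ` of the mass is re-initialised from `U^d`. -/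
def discreteStep {n k : ℕ} (R : E k → ℝ) (Φ : E n → E k) (V : E n → ℝ) (η σ : ℝ)
    (ρ : Measure (E n)) : Measure (E n) :=
  ENNReal.ofReal (1 - η * σ) • ρ.map (fun θ => θ + η • velocity R Φ V ρ θ)
    + ENNReal.ofReal (η * σ) • uniformSphere n

/-- The iterates `ρ_0, ρ_1, …` of the discrete-time update. -/
def discreteFlow {n k : ℕ} (R : E k → ℝ) (Φ : E n → E k) (V : E n → ℝ) (η σ : ℝ)
    (ρ₀ : Measure (E n)) : ℕ → Measure (E n)
  | 0 => ρ₀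
  | t + 1 => discreteStep R Φ V η σ (discreteFlow R Φ V η σ ρ₀ t)

end PerturbedWGF

end

/-!
Write `g_t = L'[ρ_t]`, `D_t = ∫ ‖∇g_t‖² dρ_t` and `Δ_t = L[ρ_t] - L⋆`.  Three facts carry the
proof.

*Descent.*  Up to an error of order `η σ`, a step decreases the objective by `η D_t / 2`, and it
moves `g_t` on the unit sphere by at most a multiple of `η √D_t` (`objective_discreteStep_le`,
`abs_tilt_discreteStep_sub_le`).  As long as the objective stays below `L[ρ₀] + 1`, the second
moments stay below a constant `M`, because `V ≥ b_V ‖·‖²`.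

*Descent directions.*  By Euler's identity `∫ g_t dρ_t` is small when `D_t` is small, so convexity
of the objective yields a unit vector at which `g_t` is below a negative multiple of `Δ_t`
(`exists_descent_direction`).

*Growth of the noise.*  Around such a direction there is a cone of directions whose uniform mass is
at least `(c ε) ^ (d + 1)`.  For small `η` the function `‖·‖² / 2 - η g` is convex and
two-homogeneous, and a transport step is the gradient map of this function.  As in the power
method its Rayleigh quotient never decreases (`power_step`), so particles in the cone stay in it and
their norms grow geometrically, as long as `g_t` moves little.  This holds with no error from the
time discretisation, so the step size need not depend on `d` or `ε`.  Within a window of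
`T ~ d log (1/ε) / (η ε)` steps, the mass `η σ` that was re-initialised at the first step would
violate the second moment bound (`mass_growth_le_secondMoment`).

Hence in every window either `D_t` is large at its start, or `g_t` has to move by a multiple of `Δ`.
In both cases, in the second by the Cauchy–Schwarz inequality, the window decreases the objective by
a multiple of `Δ² / (η T)` (`gap_sq_le_sum_dissipation`).
The recursion `Δ ↦ Δ - q Δ²` with `q ~ 1 / (η T)` reaches `ε` after `~ η T / ε` windows, hence
`~ d² log (1/ε)² / ε³` steps.  Since the decrease scales with `Δ²` rather than `ε²`, a factor `ε` is
left over, which absorbs the logarithms: `log (1/ε)² ≤ 4 / ε`.  The noise level is exponentially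
small in `d log (1/ε)`, so its contribution to the objective is negligible over all these steps,
while its logarithm enters the length of a window only linearly (`exists_schedule`).
-/

noncomputable section

namespace PerturbedWGF

/-! ### Calculus of two-homogeneous functions with Lipschitz gradient -/

section Calculus

variable {n k : ℕ}

lemma inner_gradient (f : E n → ℝ) (x y : E n) : inner ℝ (gradient f x) y = fderiv ℝ f x y :=
  inner_gradient_left

/-- First-order Taylor bound, with the (non-optimal) constant `C` in place of `C / 2`. -/
lemma GradientLipschitz.abs_taylor_le {f : E n → ℝ} {C : ℝ} (hf : Differentiable ℝ f)
    (h : GradientLipschitz f C) (hC : 0 ≤ C) (x y : E n) :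
    |f y - f x - inner ℝ (gradient f x) (y - x)| ≤ C * ‖y - x‖ ^ 2 := by
  have key := (convex_closedBall x ‖y - x‖).norm_image_sub_le_of_norm_fderiv_le' (𝕜 := ℝ)
    (f := f) (C := C * ‖y - x‖) (φ := fderiv ℝ f x) (x := x) (y := y)
    (fun z _ => hf z) (fun z hz => ?_) (by simp) (by simp [dist_eq_norm])
  · rw [inner_gradient, ← Real.norm_eq_abs]
    linarith [key]
  · rw [← toDual_gradient, ← toDual_gradient, ← map_sub, LinearIsometryEquiv.norm_map]
    refine (h z x).trans (mul_le_mul_of_nonneg_left ?_ hC)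
    simpa [dist_eq_norm] using hz

lemma IsTwoHomogeneous.map_zero {F : Type*} [AddCommGroup F] [Module ℝ F] {f : E n → F}
    (h : IsTwoHomogeneous f) : f 0 = 0 := by
  have h2 := h 2 (by norm_num) 0
  rw [smul_zero] at h2
  have h3 : (3 : ℝ) • f 0 = 0 := by
    have : (3 : ℝ) • f 0 = (2 : ℝ) ^ 2 • f 0 - f 0 := by module
    rw [this, ← h2, sub_self]
  simpa using h3

/-- Euler's identity in degree two. -/
lemma IsTwoHomogeneous.inner_gradient_self {f : E n → ℝ} (h : IsTwoHomogeneous f)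
    (hf : Differentiable ℝ f) (x : E n) : inner ℝ (gradient f x) x = 2 * f x := by
  rw [inner_gradient]
  have h1 : HasDerivAt (fun c : ℝ => f (c • x)) (fderiv ℝ f x x) 1 := by
    have hc : HasDerivAt (fun c : ℝ => c • x) x 1 := by
      simpa using (hasDerivAt_id (1 : ℝ)).smul_const x
    have hfx : HasFDerivAt f (fderiv ℝ f x) ((1 : ℝ) • x) := by
      simpa using (hf x).hasFDerivAt
    exact hfx.comp_hasDerivAt 1 hc
  have h2 : HasDerivAt (fun c : ℝ => f (c • x)) (2 * f x) 1 := by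
    have : HasDerivAt (fun c : ℝ => c ^ 2 * f x) (2 * f x) 1 := by
      simpa using (hasDerivAt_pow 2 (1 : ℝ)).mul_const (f x)
    refine this.congr_of_eventuallyEq ?_
    filter_upwards [lt_mem_nhds (zero_lt_one' ℝ)] with c hc
    simpa using h c hc x
  exact h1.unique h2

lemma IsTwoHomogeneous.gradient_zero {f : E n → ℝ} (h : IsTwoHomogeneous f)
    (hf : Differentiable ℝ f) : gradient f 0 = 0 := by
  -- The gradient is `1`-homogeneous; only `∇f (2 • 0) = 2 • ∇f 0` is needed.
  have h1 : HasFDerivAt (fun x => f ((2 : ℝ) • x)) ((2 : ℝ) • fderiv ℝ f 0) 0 := by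
    have hc : HasFDerivAt (fun x : E n => (2 : ℝ) • x)
        ((2 : ℝ) • ContinuousLinearMap.id ℝ (E n)) 0 :=
      (hasFDerivAt_id (0 : E n)).fun_const_smul 2
    have hfx : HasFDerivAt f (fderiv ℝ f 0) ((2 : ℝ) • (0 : E n)) := by
      simpa using (hf 0).hasFDerivAt
    have := hfx.comp (0 : E n) hc
    simpa [Function.comp_def] using this
  have h2 : HasFDerivAt (fun x => f ((2 : ℝ) • x)) ((4 : ℝ) • fderiv ℝ f 0) 0 := by
    have h3 : (fun x => f ((2 : ℝ) • x)) = fun x => (4 : ℝ) • f x := by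
      funext x
      rw [h 2 (by norm_num) x]
      norm_num
    rw [h3]
    exact (hf 0).hasFDerivAt.fun_const_smul 4
  have h4 := h1.unique h2
  have h5 : (2 : ℝ) • fderiv ℝ f 0 = 0 := by
    have : (2 : ℝ) • fderiv ℝ f 0 = (4 : ℝ) • fderiv ℝ f 0 - (2 : ℝ) • fderiv ℝ f 0 := by module
    rw [this, ← h4, sub_self]
  have h6 : fderiv ℝ f 0 = 0 := by simpa using h5
  rw [gradient, h6, _root_.map_zero]

lemma GradientLipschitz.norm_gradient_le {f : E n → ℝ} {C : ℝ} (hf : Differentiable ℝ f)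
    (h : GradientLipschitz f C) (hom : IsTwoHomogeneous f) (x : E n) :
    ‖gradient f x‖ ≤ C * ‖x‖ := by
  simpa [hom.gradient_zero hf] using h x 0

lemma GradientLipschitz.continuous {f : E n → ℝ} {C : ℝ} (h : GradientLipschitz f C) :
    Continuous (gradient f) := by
  have : LipschitzWith (Real.toNNReal C) (gradient f) := by
    refine LipschitzWith.of_dist_le_mul fun x y => ?_
    rw [dist_eq_norm, dist_eq_norm]
    exact (h x y).trans (mul_le_mul_of_nonneg_right (Real.le_coe_toNNReal C) (norm_nonneg _))
  exact this.continuous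

lemma IsTwoHomogeneous.eq_norm_sq_smul {F : Type*} [AddCommGroup F] [Module ℝ F] {f : E n → F}
    (h : IsTwoHomogeneous f) {x : E n} (hx : x ≠ 0) :
    f x = ‖x‖ ^ 2 • f (‖x‖⁻¹ • x) := by
  rw [← h _ (norm_pos_iff.2 hx), smul_smul, mul_inv_cancel₀ (norm_ne_zero_iff.2 hx), one_smul]

lemma norm_inv_norm_smul {x : E n} (hx : x ≠ 0) : ‖‖x‖⁻¹ • x‖ = 1 := by
  rw [norm_smul, norm_inv, norm_norm, inv_mul_cancel₀ (norm_ne_zero_iff.2 hx)]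

/-- **Power-method step.** For a two-homogeneous `g` and a small step, `F = ‖·‖² / 2 - η g` is
convex and two-homogeneous and the gradient step is `θ ↦ ∇F θ`, as in the power method.  Hence the
Rayleigh quotient `F θ / ‖θ‖²` does not decrease: no error is made by the time discretisation. -/
lemma power_step {g : E n → ℝ} {H η γ : ℝ} (hg : Differentiable ℝ g)
    (hom : IsTwoHomogeneous g) (hH : GradientLipschitz g H) (hH0 : 0 ≤ H) (hη : 0 < η)
    (hηH : η * H ≤ 1 / 2) (hγ : 0 ≤ γ) {θ : E n} (hθ : g θ ≤ -γ * ‖θ‖ ^ 2) :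
    g (θ - η • gradient g θ) ≤ -γ * ‖θ - η • gradient g θ‖ ^ 2 ∧
      (1 + 2 * (η * γ)) * ‖θ‖ ≤ ‖θ - η • gradient g θ‖ := by
  rcases eq_or_ne θ 0 with rfl | hne
  · simp [hom.gradient_zero hg, hom.map_zero]
  set u := gradient g θ with hu
  set θ' := θ - η • u with hθ'
  set a := ‖θ‖ with ha
  set b := ‖θ'‖ with hb
  have ha0 : 0 < a := norm_pos_iff.2 hne
  set F₀ := a ^ 2 / 2 - η * g θ with hF₀
  set F₁ := b ^ 2 / 2 - η * g θ' with hF₁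
  have hηγ : 0 ≤ η * γ := by positivity
  have hF₀low : (1 / 2 + η * γ) * a ^ 2 ≤ F₀ := by
    have := mul_le_mul_of_nonneg_left hθ hη.le
    rw [hF₀]; nlinarith
  have hF₀pos : 0 < F₀ := lt_of_lt_of_le (by positivity) hF₀low
  have hinner : inner ℝ θ' θ = 2 * F₀ := by
    rw [hθ', inner_sub_left, real_inner_smul_left, hom.inner_gradient_self hg,
      real_inner_self_eq_norm_sq, hF₀]
    ring
  have hab : 2 * F₀ ≤ b * a := hinner ▸ real_inner_le_norm θ' θ
  have hgrow : (1 + 2 * (η * γ)) * a ≤ b := by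
    have : ((1 + 2 * (η * γ)) * a) * a ≤ b * a := by nlinarith
    exact le_of_mul_le_mul_right this ha0
  have hb0 : 0 < b := lt_of_lt_of_le (by positivity) hgrow
  refine ⟨?_, hgrow⟩
  -- The tangent of `F` at `θ`, evaluated at `s • θ'`; this `s` gives the best bound in `hF₁low`.
  set s := 2 * F₀ / b ^ 2 with hs
  have hs0 : 0 < s := by positivity
  have hsb : s * b ^ 2 = 2 * F₀ := by rw [hs]; field_simp
  have hconv : s ^ 2 * F₁ ≥ s * b ^ 2 - F₀ := by
    have ht := (abs_le.1 (hH.abs_taylor_le hg hH0 θ (s • θ'))).2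
    rw [hom s hs0 θ', smul_eq_mul, inner_sub_right, hom.inner_gradient_self hg] at ht
    have hin : inner ℝ θ' (s • θ') = s * b ^ 2 := by
      rw [real_inner_smul_right, real_inner_self_eq_norm_sq]
    have hin2 : inner ℝ θ' (s • θ') = inner ℝ θ (s • θ') - η * inner ℝ u (s • θ') := by
      conv_lhs => rw [hθ', inner_sub_left, real_inner_smul_left]
    have hnorm : ‖s • θ' - θ‖ ^ 2 = s ^ 2 * b ^ 2 - 2 * inner ℝ θ (s • θ') + a ^ 2 := by
      rw [norm_sub_sq_real, norm_smul, Real.norm_eq_abs, abs_of_pos hs0, real_inner_comm, mul_pow]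
    have hm := mul_le_mul_of_nonneg_left ht hη.le
    have hq : η * H * ‖s • θ' - θ‖ ^ 2 ≤ 1 / 2 * ‖s • θ' - θ‖ ^ 2 :=
      mul_le_mul_of_nonneg_right hηH (sq_nonneg _)
    rw [hF₁, hF₀]
    rw [hnorm] at hq hm
    linarith
  have hF₁low : b ^ 4 ≤ 4 * F₀ * F₁ := by
    have h1 : F₀ ≤ s ^ 2 * F₁ := by linarith
    have h2 : F₀ * b ^ 4 ≤ (s * b ^ 2) ^ 2 * F₁ := by
      linarith [mul_le_mul_of_nonneg_right h1 (by positivity : 0 ≤ b ^ 4)]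
    rw [hsb] at h2
    have h3 : F₀ * b ^ 4 ≤ F₀ * (4 * F₀ * F₁) := by linarith
    exact le_of_mul_le_mul_left h3 hF₀pos
  have hF₁fin : (1 / 2 + η * γ) * b ^ 2 ≤ F₁ := by
    have h1 : (2 * F₀) ^ 2 ≤ (b * a) ^ 2 := pow_le_pow_left₀ (by positivity) hab 2
    have h2 : (1 / 2 + η * γ) * (4 * F₀) ≤ b ^ 2 := by
      have : ((1 / 2 + η * γ) * (4 * F₀)) * a ^ 2 ≤ b ^ 2 * a ^ 2 := by
        linarith [mul_le_mul_of_nonneg_left hF₀low (by positivity : 0 ≤ 4 * F₀)]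
      exact le_of_mul_le_mul_right this (by positivity)
    have h3 : (4 * F₀) * ((1 / 2 + η * γ) * b ^ 2) ≤ (4 * F₀) * F₁ := by
      linarith [mul_le_mul_of_nonneg_right h2 (sq_nonneg b)]
    exact le_of_mul_le_mul_left h3 (by positivity)
  have : η * g θ' ≤ η * (-γ * b ^ 2) := by rw [hF₁] at hF₁fin; linarith
  exact le_of_mul_le_mul_left this hη

end Calculus

/-! ### The landscape and its tilted potentials -/

/-- The hypotheses on the triple `(R, Φ, V)` that drive the convergence argument. -/
structure Landscape {n k : ℕ} (R : E k → ℝ) (Φ : E n → E k) (V : E n → ℝ)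
    (M_R C_R B_Φ C_Φ b_V B_V C_V : ℝ) : Prop where
  n_pos : 0 < n
  k_pos : 0 < k
  homΦ : IsTwoHomogeneous Φ
  homV : IsTwoHomogeneous V
  loss : RegularLoss R M_R C_R
  diffΦ : Differentiable ℝ Φ
  norm_le : ∀ θ : E n, ‖θ‖ = 1 → ‖Φ θ‖ ≤ B_Φ
  diffV : Differentiable ℝ V
  b_pos : 0 < b_V
  lower_le : ∀ θ : E n, ‖θ‖ = 1 → b_V ≤ V θ
  le_upper : ∀ θ : E n, ‖θ‖ = 1 → V θ ≤ B_V
  gradΦ : ∀ i : Fin k, GradientLipschitz (fun θ => Φ θ i) C_Φ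
  gradV : GradientLipschitz V C_V

/-- The potential `⟨w, Φ⟩ + V`; the first variation at `ρ` is the case `w = ∇R (∫ Φ dρ)`. -/
def tilt {n k : ℕ} (Φ : E n → E k) (V : E n → ℝ) (w : E k) (θ : E n) : ℝ :=
  inner ℝ w (Φ θ) + V θ

/-- A Lipschitz constant for the gradients of all tilted potentials with `‖w‖ ≤ M_R`; the summand
`1` makes it positive. -/
def smoothness (k : ℕ) (M_R C_Φ C_V : ℝ) : ℝ := k * M_R * C_Φ + C_V + 1

lemma abs_apply_le_norm {k : ℕ} (w : E k) (i : Fin k) : |w i| ≤ ‖w‖ := by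
  simpa using PiLp.norm_apply_le w i

lemma norm_le_sum_abs {k : ℕ} (w : E k) : ‖w‖ ≤ ∑ i, |w i| := by
  rw [EuclideanSpace.norm_eq]
  refine Real.sqrt_le_iff.2 ⟨Finset.sum_nonneg fun i _ => abs_nonneg _, ?_⟩
  simp only [Real.norm_eq_abs]
  exact Finset.sum_sq_le_sq_sum_of_nonneg fun i _ => abs_nonneg _

lemma GradientLipschitz.nonneg {n : ℕ} (hn : 0 < n) {f : E n → ℝ} {C : ℝ}
    (h : GradientLipschitz f C) : 0 ≤ C := by
  have := h (EuclideanSpace.single ⟨0, hn⟩ 1) 0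
  simp only [sub_zero, PiLp.norm_single, norm_one, mul_one] at this
  exact (norm_nonneg _).trans this

lemma RegularLoss.gradientLipschitz {k : ℕ} {R : E k → ℝ} {M_R C_R : ℝ}
    (h : RegularLoss R M_R C_R) : GradientLipschitz R C_R := fun x y =>
  convex_univ.norm_image_sub_le_of_norm_fderiv_le (𝕜 := ℝ)
    (fun z _ => h.differentiable_gradient z) (fun z _ => h.norm_hessian_le z)
    (mem_univ y) (mem_univ x)

lemma RegularLoss.M_nonneg {k : ℕ} {R : E k → ℝ} {M_R C_R : ℝ} (h : RegularLoss R M_R C_R) :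
    0 ≤ M_R := (norm_nonneg _).trans (h.norm_gradient_le 0)

lemma RegularLoss.C_nonneg {k : ℕ} {R : E k → ℝ} {M_R C_R : ℝ} (h : RegularLoss R M_R C_R) :
    0 ≤ C_R := (norm_nonneg _).trans (h.norm_hessian_le 0)

lemma RegularLoss.le_add {k : ℕ} {R : E k → ℝ} {M_R C_R : ℝ} (h : RegularLoss R M_R C_R)
    (x y : E k) : R y ≤ R x + inner ℝ (gradient R x) (y - x) + C_R * ‖y - x‖ ^ 2 := by
  have := (abs_le.1 (h.gradientLipschitz.abs_taylor_le h.differentiable h.C_nonneg x y)).2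
  linarith

lemma RegularLoss.lipschitz {k : ℕ} {R : E k → ℝ} {M_R C_R : ℝ} (h : RegularLoss R M_R C_R)
    (x y : E k) : R y ≤ R x + M_R * ‖y - x‖ := by
  have := convex_univ.norm_image_sub_le_of_norm_fderiv_le (𝕜 := ℝ) (f := R) (C := M_R)
    (fun z _ => h.differentiable z) (fun z _ => by
      rw [← toDual_gradient, LinearIsometryEquiv.norm_map]; exact h.norm_gradient_le z)
    (mem_univ x) (mem_univ y)
  rw [Real.norm_eq_abs] at this
  linarith [le_abs_self (R y - R x)]

/-- A differentiable convex function lies above its tangents. -/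
lemma RegularLoss.add_inner_le {k : ℕ} {R : E k → ℝ} {M_R C_R : ℝ} (h : RegularLoss R M_R C_R)
    (x y : E k) : R x + inner ℝ (gradient R x) (y - x) ≤ R y := by
  refine le_of_forall_pos_le_add fun ε hε => ?_
  set d := y - x with hd
  set m := C_R * ‖d‖ ^ 2 with hm
  have hm0 : 0 ≤ m := mul_nonneg h.C_nonneg (sq_nonneg _)
  -- Convexity is used on the first part `[x, x + t (y - x)]` of the segment, with `t` so small that
  -- the second-order error `t m` is at most `ε`.
  set t := min 1 (ε / (m + 1)) with ht
  have ht0 : 0 < t := lt_min one_pos (by positivity)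
  have ht1 : t ≤ 1 := min_le_left _ _
  have htm : t * m ≤ ε := by
    have h1 : t * (m + 1) ≤ ε := by
      rw [← le_div_iff₀ (by positivity)]; exact min_le_right _ _
    nlinarith
  have hc := h.convex.2 (mem_univ x) (mem_univ y) (sub_nonneg.2 ht1) ht0.le (by ring)
  have hx : (1 - t) • x + t • y = x + t • d := by rw [hd]; module
  have ha := (abs_le.1 (h.gradientLipschitz.abs_taylor_le h.differentiable h.C_nonneg
    x (x + t • d))).1
  rw [hx, smul_eq_mul, smul_eq_mul] at hc
  rw [add_sub_cancel_left, real_inner_smul_right, norm_smul, mul_pow, Real.norm_eq_abs,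
    sq_abs] at ha
  have h2 : t * (R x + inner ℝ (gradient R x) d) ≤ t * (R y + ε) := by
    have : t * (t * m) ≤ t * ε := mul_le_mul_of_nonneg_left htm ht0.le
    rw [hm] at this
    linarith
  exact le_of_mul_le_mul_left h2 ht0

namespace Landscape

variable {n k : ℕ} {R : E k → ℝ} {Φ : E n → E k} {V : E n → ℝ}
  {M_R C_R B_Φ C_Φ b_V B_V C_V : ℝ}

lemma exists_unit (h : Landscape R Φ V M_R C_R B_Φ C_Φ b_V B_V C_V) : ∃ θ : E n, ‖θ‖ = 1 :=
  ⟨EuclideanSpace.single ⟨0, h.n_pos⟩ 1, by simp⟩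

lemma B_Φ_nonneg (h : Landscape R Φ V M_R C_R B_Φ C_Φ b_V B_V C_V) : 0 ≤ B_Φ := by
  obtain ⟨θ, hθ⟩ := h.exists_unit
  exact (norm_nonneg _).trans (h.norm_le θ hθ)

lemma B_V_nonneg (h : Landscape R Φ V M_R C_R B_Φ C_Φ b_V B_V C_V) : 0 ≤ B_V := by
  obtain ⟨θ, hθ⟩ := h.exists_unit
  exact h.b_pos.le.trans ((h.lower_le θ hθ).trans (h.le_upper θ hθ))

lemma C_Φ_nonneg (h : Landscape R Φ V M_R C_R B_Φ C_Φ b_V B_V C_V) : 0 ≤ C_Φ :=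
  (h.gradΦ ⟨0, h.k_pos⟩).nonneg h.n_pos

lemma C_V_nonneg (h : Landscape R Φ V M_R C_R B_Φ C_Φ b_V B_V C_V) : 0 ≤ C_V :=
  h.gradV.nonneg h.n_pos

lemma smoothness_pos (h : Landscape R Φ V M_R C_R B_Φ C_Φ b_V B_V C_V) :
    0 < smoothness k M_R C_Φ C_V := by
  have := h.C_Φ_nonneg
  have := h.C_V_nonneg
  have := h.loss.M_nonneg
  unfold smoothness
  positivity

lemma norm_feature_le (h : Landscape R Φ V M_R C_R B_Φ C_Φ b_V B_V C_V) (θ : E n) :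
    ‖Φ θ‖ ≤ B_Φ * ‖θ‖ ^ 2 := by
  rcases eq_or_ne θ 0 with rfl | hne
  · simp [h.homΦ.map_zero]
  · rw [h.homΦ.eq_norm_sq_smul hne, norm_smul, norm_pow, norm_norm, mul_comm]
    exact mul_le_mul_of_nonneg_right (h.norm_le _ (norm_inv_norm_smul hne)) (sq_nonneg _)

lemma le_potential (h : Landscape R Φ V M_R C_R B_Φ C_Φ b_V B_V C_V) (θ : E n) :
    b_V * ‖θ‖ ^ 2 ≤ V θ := by
  rcases eq_or_ne θ 0 with rfl | hne
  · simp [h.homV.map_zero]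
  · rw [h.homV.eq_norm_sq_smul hne, smul_eq_mul, mul_comm]
    exact mul_le_mul_of_nonneg_left (h.lower_le _ (norm_inv_norm_smul hne)) (sq_nonneg _)

lemma potential_le (h : Landscape R Φ V M_R C_R B_Φ C_Φ b_V B_V C_V) (θ : E n) :
    V θ ≤ B_V * ‖θ‖ ^ 2 := by
  rcases eq_or_ne θ 0 with rfl | hne
  · simp [h.homV.map_zero]
  · rw [h.homV.eq_norm_sq_smul hne, smul_eq_mul, mul_comm]
    exact mul_le_mul_of_nonneg_right (h.le_upper _ (norm_inv_norm_smul hne)) (sq_nonneg _)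

lemma differentiable_coord (h : Landscape R Φ V M_R C_R B_Φ C_Φ b_V B_V C_V) (i : Fin k) :
    Differentiable ℝ fun θ => Φ θ i :=
  (differentiable_euclidean.1 h.diffΦ) i

lemma hom_coord (h : Landscape R Φ V M_R C_R B_Φ C_Φ b_V B_V C_V) (i : Fin k) :
    IsTwoHomogeneous fun θ => Φ θ i := by
  intro c hc θ
  simp [h.homΦ c hc θ]

lemma norm_feature_sub_le (h : Landscape R Φ V M_R C_R B_Φ C_Φ b_V B_V C_V) {x y : E n}
    (hxy : ‖y - x‖ ≤ ‖x‖) : ‖Φ y - Φ x‖ ≤ 2 * k * C_Φ * (‖x‖ * ‖y - x‖) := by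
  have hC := h.C_Φ_nonneg
  have hi : ∀ i, |(Φ y - Φ x) i| ≤ 2 * C_Φ * (‖x‖ * ‖y - x‖) := by
    intro i
    have h1 := (h.gradΦ i).abs_taylor_le (h.differentiable_coord i) hC x y
    have h2 := abs_real_inner_le_norm (gradient (fun θ => Φ θ i) x) (y - x)
    have h3 := (h.gradΦ i).norm_gradient_le (h.differentiable_coord i) (h.hom_coord i) x
    have h4 : ‖gradient (fun θ => Φ θ i) x‖ * ‖y - x‖ ≤ C_Φ * ‖x‖ * ‖y - x‖ :=
      mul_le_mul_of_nonneg_right h3 (norm_nonneg _)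
    have h5 : C_Φ * ‖y - x‖ ^ 2 ≤ C_Φ * (‖x‖ * ‖y - x‖) := by
      rw [sq]
      exact mul_le_mul_of_nonneg_left (mul_le_mul_of_nonneg_right hxy (norm_nonneg _)) hC
    have h6 := abs_sub_abs_le_abs_sub (Φ y i - Φ x i)
      (inner ℝ (gradient (fun θ => Φ θ i) x) (y - x))
    rw [PiLp.sub_apply]
    linarith
  calc ‖Φ y - Φ x‖ ≤ ∑ i, |(Φ y - Φ x) i| := norm_le_sum_abs _
    _ ≤ ∑ _i : Fin k, 2 * C_Φ * (‖x‖ * ‖y - x‖) := Finset.sum_le_sum fun i _ => hi i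
    _ = 2 * k * C_Φ * (‖x‖ * ‖y - x‖) := by
      rw [Finset.sum_const, Finset.card_univ, Fintype.card_fin, nsmul_eq_mul]; ring

lemma differentiable_tilt (h : Landscape R Φ V M_R C_R B_Φ C_Φ b_V B_V C_V) (w : E k) :
    Differentiable ℝ (tilt Φ V w) :=
  ((differentiable_const w).inner ℝ h.diffΦ).add h.diffV

lemma hom_tilt (h : Landscape R Φ V M_R C_R B_Φ C_Φ b_V B_V C_V) (w : E k) :
    IsTwoHomogeneous (tilt Φ V w) := by
  intro c hc θ
  simp only [tilt, h.homΦ c hc θ, h.homV c hc θ, real_inner_smul_right, smul_eq_mul]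
  ring

lemma gradient_tilt (h : Landscape R Φ V M_R C_R B_Φ C_Φ b_V B_V C_V) (w : E k) (θ : E n) :
    gradient (tilt Φ V w) θ = ∑ i, w i • gradient (fun x => Φ x i) θ + gradient V θ := by
  have h1 : tilt Φ V w = fun x => ∑ i, w i * Φ x i + V x := by
    funext x
    simp only [tilt, PiLp.inner_apply, RCLike.inner_apply, conj_trivial, mul_comm]
  have h2 : HasFDerivAt (tilt Φ V w)
      (∑ i, w i • fderiv ℝ (fun x => Φ x i) θ + fderiv ℝ V θ) θ := by
    rw [h1]
    exact (HasFDerivAt.fun_sum fun i _ =>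
      ((h.differentiable_coord i) θ).hasFDerivAt.const_mul (w i)).add (h.diffV θ).hasFDerivAt
  simp only [gradient, h2.fderiv, map_add, map_sum, map_smulₛₗ, conj_trivial]

lemma gradientLipschitz_tilt (h : Landscape R Φ V M_R C_R B_Φ C_Φ b_V B_V C_V) {w : E k}
    (hw : ‖w‖ ≤ M_R) : GradientLipschitz (tilt Φ V w) (smoothness k M_R C_Φ C_V) := by
  intro x y
  have hC := h.C_Φ_nonneg
  rw [h.gradient_tilt, h.gradient_tilt, add_sub_add_comm, ← Finset.sum_sub_distrib]
  have h1 : ‖∑ i, (w i • gradient (fun x => Φ x i) x - w i • gradient (fun x => Φ x i) y)‖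
      ≤ ∑ _i : Fin k, M_R * (C_Φ * ‖x - y‖) := by
    refine norm_sum_le_of_le _ fun i _ => ?_
    rw [← smul_sub, norm_smul]
    exact mul_le_mul ((abs_apply_le_norm w i).trans hw) (h.gradΦ i x y) (norm_nonneg _)
      h.loss.M_nonneg
  rw [Finset.sum_const, Finset.card_univ, Fintype.card_fin, nsmul_eq_mul] at h1
  refine (norm_add_le _ _).trans ?_
  have h2 := h.gradV x y
  unfold smoothness
  nlinarith [norm_nonneg (x - y)]

lemma norm_gradient_tilt_le (h : Landscape R Φ V M_R C_R B_Φ C_Φ b_V B_V C_V) {w : E k}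
    (hw : ‖w‖ ≤ M_R) (θ : E n) :
    ‖gradient (tilt Φ V w) θ‖ ≤ smoothness k M_R C_Φ C_V * ‖θ‖ :=
  (h.gradientLipschitz_tilt hw).norm_gradient_le (h.differentiable_tilt w) (h.hom_tilt w) θ

lemma abs_tilt_sub_le (h : Landscape R Φ V M_R C_R B_Φ C_Φ b_V B_V C_V) (w w' : E k) (θ : E n) :
    |tilt Φ V w' θ - tilt Φ V w θ| ≤ B_Φ * ‖w' - w‖ * ‖θ‖ ^ 2 := by
  have h1 : tilt Φ V w' θ - tilt Φ V w θ = inner ℝ (w' - w) (Φ θ) := by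
    simp only [tilt, inner_sub_left]; ring
  rw [h1]
  refine (abs_real_inner_le_norm _ _).trans ?_
  have := mul_le_mul_of_nonneg_left (h.norm_feature_le θ) (norm_nonneg (w' - w))
  linarith

end Landscape

/-! ### Integrals against admissible measures -/

/-- The second moment `∫ ‖θ‖² dρ`. -/
def secondMoment {n : ℕ} (ρ : Measure (E n)) : ℝ := ∫ θ, ‖θ‖ ^ 2 ∂ρ

/-- The barycentre `∫ Φ dρ` of the features. -/
def meanFeature {n k : ℕ} (Φ : E n → E k) (ρ : Measure (E n)) : E k := ∫ θ, Φ θ ∂ρ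

/-- The direction `∇R (∫ Φ dρ)` along which the first variation at `ρ` tilts the potential. -/
def lossGradient {n k : ℕ} (R : E k → ℝ) (Φ : E n → E k) (ρ : Measure (E n)) : E k :=
  gradient R (meanFeature Φ ρ)

/-- The squared gradient norm `∫ ‖∇L'[ρ]‖² dρ`, the dissipation of the unperturbed flow. -/
def dissipation {n k : ℕ} (R : E k → ℝ) (Φ : E n → E k) (V : E n → ℝ) (ρ : Measure (E n)) : ℝ :=
  ∫ θ, ‖gradient (tilt Φ V (lossGradient R Φ ρ)) θ‖ ^ 2 ∂ρ

lemma velocity_eq {n k : ℕ} (R : E k → ℝ) (Φ : E n → E k) (V : E n → ℝ) (ρ : Measure (E n))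
    (θ : E n) : velocity R Φ V ρ θ = -gradient (tilt Φ V (lossGradient R Φ ρ)) θ := rfl

lemma IsAdmissible.integrable_of_le {n : ℕ} {F : Type*} [NormedAddCommGroup F]
    {ρ : Measure (E n)} (hρ : IsAdmissible ρ) {f : E n → F} (hf : Continuous f)
    [SecondCountableTopologyEither (E n) F] {C : ℝ}
    (hC : ∀ θ, ‖f θ‖ ≤ C * ‖θ‖ ^ 2) : Integrable f ρ :=
  (hρ.secondMoment.const_mul C).mono' hf.aestronglyMeasurable (Filter.Eventually.of_forall hC)

lemma secondMoment_nonneg {n : ℕ} (ρ : Measure (E n)) : 0 ≤ secondMoment ρ :=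
  integral_nonneg fun _ => sq_nonneg _

lemma dissipation_nonneg {n k : ℕ} (R : E k → ℝ) (Φ : E n → E k) (V : E n → ℝ)
    (ρ : Measure (E n)) : 0 ≤ dissipation R Φ V ρ :=
  integral_nonneg fun _ => sq_nonneg _

/-- Cauchy–Schwarz for the product of two norms. -/
lemma integral_norm_mul_norm_le {n : ℕ} {F : Type*} [NormedAddCommGroup F]
    {ρ : Measure (E n)} {f g : E n → F}
    (hf : AEStronglyMeasurable f ρ) (hg : AEStronglyMeasurable g ρ)
    (hf2 : Integrable (fun θ => ‖f θ‖ ^ 2) ρ) (hg2 : Integrable (fun θ => ‖g θ‖ ^ 2) ρ) :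
    ∫ θ, ‖f θ‖ * ‖g θ‖ ∂ρ ≤ √(∫ θ, ‖f θ‖ ^ 2 ∂ρ) * √(∫ θ, ‖g θ‖ ^ 2 ∂ρ) := by
  have hp : Real.HolderConjugate 2 2 := Real.HolderConjugate.two_two
  have h1 : MemLp f (ENNReal.ofReal 2) ρ := by
    simpa using (memLp_two_iff_integrable_sq_norm hf).2 hf2
  have h2 : MemLp g (ENNReal.ofReal 2) ρ := by
    simpa using (memLp_two_iff_integrable_sq_norm hg).2 hg2
  have := integral_mul_norm_le_Lp_mul_Lq hp h1 h2
  simpa [Real.sqrt_eq_rpow] using this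

namespace Landscape

variable {n k : ℕ} {R : E k → ℝ} {Φ : E n → E k} {V : E n → ℝ}
  {M_R C_R B_Φ C_Φ b_V B_V C_V : ℝ} {μ π : Measure (E n)}

lemma integrable_feature (h : Landscape R Φ V M_R C_R B_Φ C_Φ b_V B_V C_V)
    (hμ : IsAdmissible μ) : Integrable Φ μ :=
  hμ.integrable_of_le h.diffΦ.continuous h.norm_feature_le

lemma integrable_potential (h : Landscape R Φ V M_R C_R B_Φ C_Φ b_V B_V C_V)
    (hμ : IsAdmissible μ) : Integrable V μ := by
  refine hμ.integrable_of_le h.diffV.continuous (C := B_V) fun θ => ?_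
  have := h.le_potential θ
  have := mul_nonneg h.b_pos.le (sq_nonneg ‖θ‖)
  rw [Real.norm_eq_abs, abs_of_nonneg (by linarith)]
  exact h.potential_le θ

lemma integrable_tilt (h : Landscape R Φ V M_R C_R B_Φ C_Φ b_V B_V C_V)
    (hμ : IsAdmissible μ) (w : E k) : Integrable (tilt Φ V w) μ :=
  ((h.integrable_feature hμ).const_inner w).add (h.integrable_potential hμ)

lemma integral_tilt (h : Landscape R Φ V M_R C_R B_Φ C_Φ b_V B_V C_V)
    (hμ : IsAdmissible μ) (w : E k) :
    ∫ θ, tilt Φ V w θ ∂μ = inner ℝ w (meanFeature Φ μ) + ∫ θ, V θ ∂μ := by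
  simp only [tilt]
  rw [integral_add ((h.integrable_feature hμ).const_inner w) (h.integrable_potential hμ),
    integral_inner (h.integrable_feature hμ), meanFeature]

lemma norm_lossGradient_le (h : Landscape R Φ V M_R C_R B_Φ C_Φ b_V B_V C_V)
    (μ : Measure (E n)) : ‖lossGradient R Φ μ‖ ≤ M_R := h.loss.norm_gradient_le _

lemma integrable_gradient_sq (h : Landscape R Φ V M_R C_R B_Φ C_Φ b_V B_V C_V)
    (hμ : IsAdmissible μ) {w : E k} (hw : ‖w‖ ≤ M_R) :
    Integrable (fun θ => ‖gradient (tilt Φ V w) θ‖ ^ 2) μ := by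
  refine hμ.integrable_of_le ((h.gradientLipschitz_tilt hw).continuous.norm.pow 2)
    (C := smoothness k M_R C_Φ C_V ^ 2) fun θ => ?_
  rw [norm_pow, norm_norm, ← mul_pow]
  exact pow_le_pow_left₀ (norm_nonneg _) (h.norm_gradient_tilt_le hw θ) 2

lemma norm_meanFeature_le (h : Landscape R Φ V M_R C_R B_Φ C_Φ b_V B_V C_V)
    (hμ : IsAdmissible μ) : ‖meanFeature Φ μ‖ ≤ B_Φ * secondMoment μ := by
  rw [secondMoment, ← integral_const_mul]
  exact norm_integral_le_of_norm_le (hμ.secondMoment.const_mul _)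
    (Filter.Eventually.of_forall h.norm_feature_le)

lemma secondMoment_le (h : Landscape R Φ V M_R C_R B_Φ C_Φ b_V B_V C_V)
    (hμ : IsAdmissible μ) : b_V * secondMoment μ ≤ objective R Φ V μ := by
  have h1 : b_V * secondMoment μ ≤ ∫ θ, V θ ∂μ := by
    rw [secondMoment, ← integral_const_mul]
    exact integral_mono (hμ.secondMoment.const_mul _) (h.integrable_potential hμ) h.le_potential
  have := h.loss.nonneg (∫ θ, Φ θ ∂μ)
  unfold objective
  linarith

lemma objective_nonneg (h : Landscape R Φ V M_R C_R B_Φ C_Φ b_V B_V C_V)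
    (hμ : IsAdmissible μ) : 0 ≤ objective R Φ V μ :=
  (mul_nonneg h.b_pos.le (secondMoment_nonneg μ)).trans (h.secondMoment_le hμ)

lemma secondMoment_le_of_objective_le (h : Landscape R Φ V M_R C_R B_Φ C_Φ b_V B_V C_V)
    (hμ : IsAdmissible μ) {M : ℝ} (hM : objective R Φ V μ ≤ b_V * M) : secondMoment μ ≤ M :=
  le_of_mul_le_mul_left ((h.secondMoment_le hμ).trans hM) h.b_pos

/-- The objective is convex, with the first variation as its derivative. -/
lemma objective_tangent (h : Landscape R Φ V M_R C_R B_Φ C_Φ b_V B_V C_V)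
    (hμ : IsAdmissible μ) (hπ : IsAdmissible π) :
    objective R Φ V μ + ∫ θ, tilt Φ V (lossGradient R Φ μ) θ ∂π
      - ∫ θ, tilt Φ V (lossGradient R Φ μ) θ ∂μ ≤ objective R Φ V π := by
  have := h.loss.add_inner_le (meanFeature Φ μ) (meanFeature Φ π)
  rw [inner_sub_right] at this
  rw [h.integral_tilt hμ, h.integral_tilt hπ]
  simp only [objective, lossGradient, meanFeature] at *
  linarith

lemma objective_le_add (h : Landscape R Φ V M_R C_R B_Φ C_Φ b_V B_V C_V)
    (hμ : IsAdmissible μ) (hπ : IsAdmissible π) :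
    objective R Φ V π ≤ objective R Φ V μ + ∫ θ, tilt Φ V (lossGradient R Φ μ) θ ∂π
      - ∫ θ, tilt Φ V (lossGradient R Φ μ) θ ∂μ
      + C_R * ‖meanFeature Φ π - meanFeature Φ μ‖ ^ 2 := by
  have := h.loss.le_add (meanFeature Φ μ) (meanFeature Φ π)
  rw [inner_sub_right] at this
  rw [h.integral_tilt hμ, h.integral_tilt hπ]
  simp only [objective, lossGradient, meanFeature] at *
  linarith

/-- By Euler's identity the first variation has a small integral when the dissipation is small. -/
lemma abs_integral_tilt_le (h : Landscape R Φ V M_R C_R B_Φ C_Φ b_V B_V C_V)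
    (hμ : IsAdmissible μ) :
    2 * |∫ θ, tilt Φ V (lossGradient R Φ μ) θ ∂μ| ≤
      √(secondMoment μ) * √(dissipation R Φ V μ) := by
  set w := lossGradient R Φ μ
  have hw : ‖w‖ ≤ M_R := h.norm_lossGradient_le μ
  have hcont := (h.gradientLipschitz_tilt hw).continuous
  have h1 : ∀ θ, 2 * |tilt Φ V w θ| ≤ ‖θ‖ * ‖gradient (tilt Φ V w) θ‖ := fun θ => by
    have := abs_real_inner_le_norm (gradient (tilt Φ V w) θ) θ
    rw [(h.hom_tilt w).inner_gradient_self (h.differentiable_tilt w), abs_mul, abs_two] at this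
    linarith
  have hint : Integrable (fun θ => ‖θ‖ * ‖gradient (tilt Φ V w) θ‖) μ := by
    refine hμ.integrable_of_le (continuous_norm.mul hcont.norm)
      (C := smoothness k M_R C_Φ C_V) fun θ => ?_
    rw [norm_mul, norm_norm, norm_norm]
    have := mul_le_mul_of_nonneg_left (h.norm_gradient_tilt_le hw θ) (norm_nonneg θ)
    linarith
  calc 2 * |∫ θ, tilt Φ V w θ ∂μ| ≤ 2 * ∫ θ, |tilt Φ V w θ| ∂μ :=
        mul_le_mul_of_nonneg_left abs_integral_le_integral_abs zero_le_two
    _ = ∫ θ, 2 * |tilt Φ V w θ| ∂μ := (integral_const_mul _ _).symm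
    _ ≤ ∫ θ, ‖θ‖ * ‖gradient (tilt Φ V w) θ‖ ∂μ :=
        integral_mono ((h.integrable_tilt hμ w).abs.const_mul 2) hint h1
    _ ≤ _ := integral_norm_mul_norm_le (f := fun θ : E n => θ) aestronglyMeasurable_id
        hcont.aestronglyMeasurable hμ.secondMoment (h.integrable_gradient_sq hμ hw)

/-- Far from the optimum, at a nearly stationary measure, the first variation is substantially
negative in some direction. -/
lemma exists_descent_direction (h : Landscape R Φ V M_R C_R B_Φ C_Φ b_V B_V C_V)
    (hμ : IsAdmissible μ) {M Δ : ℝ} (hM : 0 < M) (hμM : objective R Φ V μ ≤ b_V * M)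
    (hΔ : 0 < Δ) (hgap : Δ ≤ objective R Φ V μ - optimalValue R Φ V)
    (hD : 4 * M * dissipation R Φ V μ ≤ Δ ^ 2) :
    ∃ θ : E n, ‖θ‖ = 1 ∧ tilt Φ V (lossGradient R Φ μ) θ ≤ -(Δ / (8 * M)) := by
  have : Nonempty {ρ : Measure (E n) // IsAdmissible ρ} := ⟨⟨μ, hμ⟩⟩
  obtain ⟨⟨π, hπ⟩, hπL⟩ := exists_lt_of_ciInf_lt
    (show optimalValue R Φ V < objective R Φ V μ - Δ / 2 by linarith)
  set w := lossGradient R Φ μ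
  have hπL' : objective R Φ V π < objective R Φ V μ - Δ / 2 := hπL
  have hπM : secondMoment π ≤ M := h.secondMoment_le_of_objective_le hπ (by linarith)
  have hμM' := h.secondMoment_le_of_objective_le hμ hμM
  have htan := h.objective_tangent hμ hπ
  have hsmall : √(secondMoment μ) * √(dissipation R Φ V μ) ≤ Δ / 2 := by
    rw [← Real.sqrt_mul (secondMoment_nonneg μ)]
    refine Real.sqrt_le_iff.2 ⟨by positivity, ?_⟩
    have := mul_le_mul_of_nonneg_right hμM' (dissipation_nonneg R Φ V μ)
    nlinarith
  have habs := h.abs_integral_tilt_le hμ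
  have hneg := neg_abs_le (∫ θ, tilt Φ V w θ ∂μ)
  have hle := le_abs_self (∫ θ, tilt Φ V w θ ∂μ)
  have hπint : ∫ θ, tilt Φ V w θ ∂π < -(Δ / 4) := by
    linarith
  by_contra hcon
  push Not at hcon
  have hlow : ∀ θ : E n, -(Δ / (8 * M)) * ‖θ‖ ^ 2 ≤ tilt Φ V w θ := fun θ => by
    rcases eq_or_ne θ 0 with rfl | hne
    · simp [(h.hom_tilt w).map_zero]
    · rw [(h.hom_tilt w).eq_norm_sq_smul hne, smul_eq_mul, mul_comm]
      exact mul_le_mul_of_nonneg_left (hcon _ (norm_inv_norm_smul hne)).le (sq_nonneg _)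
  have h1 := integral_mono (hπ.secondMoment.const_mul (-(Δ / (8 * M))))
    (h.integrable_tilt hπ w) hlow
  rw [integral_const_mul] at h1
  have h2 : Δ / (8 * M) * secondMoment π ≤ Δ / (8 * M) * M :=
    mul_le_mul_of_nonneg_left hπM (by positivity)
  have h3 : Δ / (8 * M) * M = Δ / 8 := by field_simp
  simp only [secondMoment] at h2
  linarith

end Landscape

/-! ### The uniform distribution on the sphere -/

section UniformSphere

variable {n : ℕ}

lemma toSphere_univ_ne_zero (hn : 0 < n) : (volume : Measure (E n)).toSphere univ ≠ 0 := by
  have : Nonempty (Fin n) := ⟨⟨0, hn⟩⟩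
  rw [Ne, Measure.measure_univ_eq_zero]
  exact Measure.toSphere_ne_zero _

lemma isProbabilityMeasure_uniformSphere (hn : 0 < n) :
    IsProbabilityMeasure (uniformSphere n) := by
  have h : IsProbabilityMeasure
      (((volume : Measure (E n)).toSphere univ)⁻¹ • (volume : Measure (E n)).toSphere) :=
    ⟨by
      rw [Measure.smul_apply, smul_eq_mul]
      exact ENNReal.inv_mul_cancel (toSphere_univ_ne_zero hn) (measure_ne_top _ _)⟩
  exact Measure.isProbabilityMeasure_map measurable_subtype_coe.aemeasurable

lemma ae_uniformSphere_norm_eq_one : ∀ᵐ θ ∂(uniformSphere n), ‖θ‖ = 1 := by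
  refine (ae_map_iff measurable_subtype_coe.aemeasurable
    (measurableSet_eq_fun measurable_norm measurable_const)).2 ?_
  exact Filter.Eventually.of_forall fun θ => by simp

lemma isAdmissible_uniformSphere (hn : 0 < n) : IsAdmissible (uniformSphere n) := by
  have := isProbabilityMeasure_uniformSphere hn
  refine ⟨this, (integrable_const (1 : ℝ)).congr ?_⟩
  filter_upwards [ae_uniformSphere_norm_eq_one] with θ hθ
  rw [hθ, one_pow]

lemma secondMoment_uniformSphere (hn : 0 < n) : secondMoment (uniformSphere n) = 1 := by
  have := isProbabilityMeasure_uniformSphere hn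
  have h : ∫ θ, ‖θ‖ ^ 2 ∂(uniformSphere n) = ∫ _, (1 : ℝ) ∂(uniformSphere n) := by
    refine integral_congr_ae ?_
    filter_upwards [ae_uniformSphere_norm_eq_one] with θ hθ
    rw [hθ, one_pow]
  rw [secondMoment, h]
  simp

open scoped Pointwise in
/-- The uniform measure of a cone is at least the relative volume of a ball that it contains. -/
lemma pow_le_uniformSphere_real (hn : 0 < n) {S : Set (E n)} (hS : MeasurableSet S)
    (hcone : ∀ c : ℝ, 0 < c → ∀ θ ∈ S, c • θ ∈ S) {θ₀ : E n} {r : ℝ} (hr : 0 ≤ r)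
    (h1 : ∀ θ ∈ Metric.ball θ₀ r, θ ≠ 0 ∧ ‖θ‖ < 1 ∧ θ ∈ S) :
    r ^ n ≤ (uniformSphere n).real S := by
  have : Nonempty (Fin n) := ⟨⟨0, hn⟩⟩
  have hprob := isProbabilityMeasure_uniformSphere hn
  set v := (volume : Measure (E n)) with hv
  have hmeas : MeasurableSet (Subtype.val ⁻¹' S : Set (Metric.sphere (0 : E n) 1)) :=
    measurable_subtype_coe hS
  have hsub : Metric.ball θ₀ r ⊆
      Ioo (0 : ℝ) 1 • (Subtype.val '' (Subtype.val ⁻¹' S : Set (Metric.sphere (0 : E n) 1))) := by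
    intro θ hθ
    obtain ⟨hne, hlt, hθS⟩ := h1 θ hθ
    refine mem_smul.2 ⟨‖θ‖, ⟨norm_pos_iff.2 hne, hlt⟩, ‖θ‖⁻¹ • θ, ?_, ?_⟩
    · exact ⟨⟨‖θ‖⁻¹ • θ, by simpa using norm_inv_norm_smul hne⟩,
        hcone _ (inv_pos.2 (norm_pos_iff.2 hne)) θ hθS, rfl⟩
    · rw [smul_smul, mul_inv_cancel₀ (norm_ne_zero_iff.2 hne), one_smul]
  have hkey : ENNReal.ofReal (r ^ n) ≤ uniformSphere n S := by
    rw [uniformSphere, Measure.map_apply measurable_subtype_coe hS, Measure.smul_apply,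
      smul_eq_mul, mul_comm, ← div_eq_mul_inv,
      ENNReal.le_div_iff_mul_le (Or.inl (toSphere_univ_ne_zero hn))
        (Or.inl (measure_ne_top _ _)),
      Measure.toSphere_apply' _ hmeas, Measure.toSphere_apply_univ, mul_left_comm]
    refine mul_le_mul_right ?_ _
    refine le_trans (le_of_eq ?_) (measure_mono hsub)
    rw [Measure.addHaar_ball _ _ hr, finrank_euclideanSpace_fin]
  exact (ENNReal.ofReal_le_iff_le_toReal (measure_ne_top _ _)).1 hkey

end UniformSphere

/-! ### One step of the dynamics -/

/-- The transport map `θ ↦ θ + η v[ρ](θ)`. -/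
def transport {n k : ℕ} (R : E k → ℝ) (Φ : E n → E k) (V : E n → ℝ) (η : ℝ)
    (ρ : Measure (E n)) (θ : E n) : E n :=
  θ - η • gradient (tilt Φ V (lossGradient R Φ ρ)) θ

lemma discreteStep_eq {n k : ℕ} (R : E k → ℝ) (Φ : E n → E k) (V : E n → ℝ) (η σ : ℝ)
    (ρ : Measure (E n)) :
    discreteStep R Φ V η σ ρ = ENNReal.ofReal (1 - η * σ) • ρ.map (transport R Φ V η ρ)
      + ENNReal.ofReal (η * σ) • uniformSphere n := by
  have : (fun θ => θ + η • velocity R Φ V ρ θ) = transport R Φ V η ρ := by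
    funext θ
    rw [velocity_eq, transport, smul_neg, sub_eq_add_neg]
  rw [discreteStep, this]

/-- The convex combination `(1 - p) ν + p π` of two measures. -/
def mixture {n : ℕ} (p : ℝ) (ν π : Measure (E n)) : Measure (E n) :=
  ENNReal.ofReal (1 - p) • ν + ENNReal.ofReal p • π

section Mixture

variable {n : ℕ} {p : ℝ} {ν π : Measure (E n)}

lemma IsAdmissible.mixture (hν : IsAdmissible ν) (hπ : IsAdmissible π) (hp0 : 0 ≤ p)
    (hp1 : p ≤ 1) : IsAdmissible (mixture p ν π) := by
  have := hν.prob
  have := hπ.prob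
  refine ⟨⟨?_⟩, ?_⟩
  · simp only [PerturbedWGF.mixture, Measure.add_apply, Measure.smul_apply, measure_univ,
      smul_eq_mul, mul_one]
    rw [← ENNReal.ofReal_add (sub_nonneg.2 hp1) hp0]
    simp
  · exact (hν.secondMoment.smul_measure ENNReal.ofReal_ne_top).add_measure
      (hπ.secondMoment.smul_measure ENNReal.ofReal_ne_top)

lemma integral_mixture {F : Type*} [NormedAddCommGroup F] [NormedSpace ℝ F]
    (hp0 : 0 ≤ p) (hp1 : p ≤ 1) {f : E n → F} (hν : Integrable f ν) (hπ : Integrable f π) :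
    ∫ θ, f θ ∂(mixture p ν π) = (1 - p) • ∫ θ, f θ ∂ν + p • ∫ θ, f θ ∂π := by
  rw [mixture, integral_add_measure (hν.smul_measure ENNReal.ofReal_ne_top)
    (hπ.smul_measure ENNReal.ofReal_ne_top), integral_smul_measure, integral_smul_measure,
    ENNReal.toReal_ofReal hp0, ENNReal.toReal_ofReal (sub_nonneg.2 hp1)]

lemma mixture_real_apply [IsFiniteMeasure ν] [IsFiniteMeasure π] (hp0 : 0 ≤ p) (hp1 : p ≤ 1)
    (S : Set (E n)) : (mixture p ν π).real S = (1 - p) * ν.real S + p * π.real S := by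
  simp only [mixture, Measure.real, Measure.add_apply, Measure.smul_apply, smul_eq_mul]
  rw [ENNReal.toReal_add (ENNReal.mul_ne_top ENNReal.ofReal_ne_top (measure_ne_top _ _))
    (ENNReal.mul_ne_top ENNReal.ofReal_ne_top (measure_ne_top _ _)), ENNReal.toReal_mul,
    ENNReal.toReal_mul, ENNReal.toReal_ofReal hp0, ENNReal.toReal_ofReal (sub_nonneg.2 hp1)]

end Mixture

namespace Landscape

variable {n k : ℕ} {R : E k → ℝ} {Φ : E n → E k} {V : E n → ℝ}
  {M_R C_R B_Φ C_Φ b_V B_V C_V : ℝ} {μ ν π : Measure (E n)} {η p M : ℝ}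

lemma continuous_transport (h : Landscape R Φ V M_R C_R B_Φ C_Φ b_V B_V C_V) (η : ℝ)
    (μ : Measure (E n)) : Continuous (transport R Φ V η μ) :=
  continuous_id.sub
    ((h.gradientLipschitz_tilt (h.norm_lossGradient_le μ)).continuous.const_smul η)

lemma isAdmissible_transport (h : Landscape R Φ V M_R C_R B_Φ C_Φ b_V B_V C_V)
    (hμ : IsAdmissible μ) (η : ℝ) : IsAdmissible (μ.map (transport R Φ V η μ)) := by
  have := hμ.prob
  have hc := h.continuous_transport η μ
  refine ⟨Measure.isProbabilityMeasure_map hc.measurable.aemeasurable, ?_⟩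
  rw [integrable_map_measure (by fun_prop) hc.measurable.aemeasurable]
  refine hμ.integrable_of_le (by fun_prop) (C := (1 + |η| * smoothness k M_R C_Φ C_V) ^ 2)
    fun θ => ?_
  have h1 : ‖transport R Φ V η μ θ‖ ≤ (1 + |η| * smoothness k M_R C_Φ C_V) * ‖θ‖ := by
    refine (norm_sub_le _ _).trans ?_
    rw [norm_smul, Real.norm_eq_abs]
    have := mul_le_mul_of_nonneg_left
      (h.norm_gradient_tilt_le (h.norm_lossGradient_le μ) θ) (abs_nonneg η)
    linarith
  rw [Function.comp_apply, norm_pow, norm_norm, ← mul_pow]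
  exact pow_le_pow_left₀ (norm_nonneg _) h1 2

lemma isAdmissible_discreteStep (h : Landscape R Φ V M_R C_R B_Φ C_Φ b_V B_V C_V)
    (hμ : IsAdmissible μ) {σ : ℝ} (hp0 : 0 ≤ η * σ) (hp1 : η * σ ≤ 1) :
    IsAdmissible (discreteStep R Φ V η σ μ) := by
  rw [discreteStep_eq]
  exact (h.isAdmissible_transport hμ η).mixture (isAdmissible_uniformSphere h.n_pos) hp0 hp1

lemma meanFeature_mixture (h : Landscape R Φ V M_R C_R B_Φ C_Φ b_V B_V C_V)
    (hν : IsAdmissible ν) (hπ : IsAdmissible π) (hp0 : 0 ≤ p) (hp1 : p ≤ 1) :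
    meanFeature Φ (mixture p ν π) = (1 - p) • meanFeature Φ ν + p • meanFeature Φ π :=
  integral_mixture hp0 hp1 (h.integrable_feature hν) (h.integrable_feature hπ)

lemma objective_mixture_le (h : Landscape R Φ V M_R C_R B_Φ C_Φ b_V B_V C_V)
    (hν : IsAdmissible ν) (hπ : IsAdmissible π) (hp0 : 0 ≤ p) (hp1 : p ≤ 1) :
    objective R Φ V (mixture p ν π) ≤ (1 - p) * objective R Φ V ν + p * objective R Φ V π := by
  have h1 := h.meanFeature_mixture hν hπ hp0 hp1
  have h2 := integral_mixture hp0 hp1 (h.integrable_potential hν) (h.integrable_potential hπ)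
  have h3 := h.loss.convex.2 (mem_univ (meanFeature Φ ν)) (mem_univ (meanFeature Φ π))
    (sub_nonneg.2 hp1) hp0 (by ring)
  rw [← h1] at h3
  simp only [smul_eq_mul] at h2 h3
  simp only [objective, meanFeature] at *
  rw [h2]
  linarith

lemma transport_sub (θ : E n) : transport R Φ V η μ θ - θ =
    -(η • gradient (tilt Φ V (lossGradient R Φ μ)) θ) := by
  simp [transport]

/-- How far one transport step moves the mean feature, in terms of the dissipation. -/
lemma norm_meanFeature_transport_sub_le (h : Landscape R Φ V M_R C_R B_Φ C_Φ b_V B_V C_V)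
    (hμ : IsAdmissible μ) (hη : 0 ≤ η) (hηH : η * smoothness k M_R C_Φ C_V ≤ 1) :
    ‖meanFeature Φ (μ.map (transport R Φ V η μ)) - meanFeature Φ μ‖ ≤
      2 * k * C_Φ * η * (√(secondMoment μ) * √(dissipation R Φ V μ)) := by
  have hw := h.norm_lossGradient_le μ
  have hc := h.continuous_transport η μ
  have hgc := (h.gradientLipschitz_tilt hw).continuous
  have hΦc := h.diffΦ.continuous
  have hν := h.isAdmissible_transport hμ η
  have hint : Integrable (fun θ => Φ (transport R Φ V η μ θ)) μ :=
    (integrable_map_measure hΦc.aestronglyMeasurable hc.measurable.aemeasurable).1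
      (h.integrable_feature hν)
  have hC := h.C_Φ_nonneg
  rw [meanFeature, meanFeature, integral_map hc.measurable.aemeasurable
    hΦc.aestronglyMeasurable, ← integral_sub hint (h.integrable_feature hμ)]
  set w := lossGradient R Φ μ with hwdef
  have hprod : Integrable (fun θ => ‖θ‖ * ‖gradient (tilt Φ V w) θ‖) μ := by
    refine hμ.integrable_of_le (continuous_norm.mul hgc.norm)
      (C := smoothness k M_R C_Φ C_V) fun θ => ?_
    rw [norm_mul, norm_norm, norm_norm]
    have := mul_le_mul_of_nonneg_left (h.norm_gradient_tilt_le hw θ) (norm_nonneg θ)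
    linarith
  have hpt : ∀ θ, ‖Φ (transport R Φ V η μ θ) - Φ θ‖ ≤
      2 * k * C_Φ * η * (‖θ‖ * ‖gradient (tilt Φ V w) θ‖) := fun θ => by
    have hn : ‖transport R Φ V η μ θ - θ‖ = η * ‖gradient (tilt Φ V w) θ‖ := by
      rw [transport_sub, norm_neg, norm_smul, Real.norm_eq_abs, abs_of_nonneg hη]
    have h1 : ‖transport R Φ V η μ θ - θ‖ ≤ ‖θ‖ := by
      rw [hn]
      have h2 := mul_le_mul_of_nonneg_left (h.norm_gradient_tilt_le hw θ) hη
      have h3 := mul_le_mul_of_nonneg_right hηH (norm_nonneg θ)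
      linarith
    have := h.norm_feature_sub_le h1
    rw [hn] at this
    linarith
  refine (norm_integral_le_of_norm_le (hprod.const_mul _)
    (Filter.Eventually.of_forall hpt)).trans ?_
  rw [integral_const_mul]
  refine mul_le_mul_of_nonneg_left ?_ (by positivity)
  exact integral_norm_mul_norm_le (f := fun θ : E n => θ) aestronglyMeasurable_id
        hgc.aestronglyMeasurable hμ.secondMoment (h.integrable_gradient_sq hμ hw)

/-- The transport part of a step decreases the objective in proportion to the dissipation. -/
lemma objective_transport_le (h : Landscape R Φ V M_R C_R B_Φ C_Φ b_V B_V C_V)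
    (hμ : IsAdmissible μ) (hη : 0 ≤ η) (hηH : η * (4 * smoothness k M_R C_Φ C_V) ≤ 1)
    (hμM : secondMoment μ ≤ M) (hηM : η * (16 * C_R * k ^ 2 * C_Φ ^ 2 * M) ≤ 1) :
    objective R Φ V (μ.map (transport R Φ V η μ)) ≤
      objective R Φ V μ - η / 2 * dissipation R Φ V μ := by
  have hw := h.norm_lossGradient_le μ
  have hH := h.smoothness_pos
  have hc := h.continuous_transport η μ
  have hν := h.isAdmissible_transport hμ η
  have hD := dissipation_nonneg R Φ V μ
  have hmv := h.norm_meanFeature_transport_sub_le hμ hη (by nlinarith)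
  have hadd := h.objective_le_add hμ hν
  have hsq : ‖meanFeature Φ (μ.map (transport R Φ V η μ)) - meanFeature Φ μ‖ ^ 2 ≤
      (2 * k * C_Φ * η) ^ 2 * (M * dissipation R Φ V μ) := by
    refine (pow_le_pow_left₀ (norm_nonneg _) hmv 2).trans ?_
    rw [mul_pow, mul_pow (√(secondMoment μ)), Real.sq_sqrt (secondMoment_nonneg μ),
      Real.sq_sqrt hD]
    exact mul_le_mul_of_nonneg_left (mul_le_mul_of_nonneg_right hμM hD) (sq_nonneg _)
  have hquad : C_R * ‖meanFeature Φ (μ.map (transport R Φ V η μ)) - meanFeature Φ μ‖ ^ 2 ≤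
      η / 4 * dissipation R Φ V μ := by
    have h1 := mul_le_mul_of_nonneg_left hsq h.loss.C_nonneg
    have h2 := mul_le_mul_of_nonneg_right hηM (mul_nonneg hη hD)
    linarith
  set w := lossGradient R Φ μ with hwdef
  have htilt : ∫ θ, tilt Φ V w θ ∂(μ.map (transport R Φ V η μ)) ≤
      ∫ θ, tilt Φ V w θ ∂μ - 3 / 4 * η * dissipation R Φ V μ := by
    have hgc := (h.differentiable_tilt w).continuous
    have hint : Integrable (fun θ => tilt Φ V w (transport R Φ V η μ θ)) μ :=
      (integrable_map_measure hgc.aestronglyMeasurable hc.measurable.aemeasurable).1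
        (h.integrable_tilt hν w)
    have hg2 := (h.integrable_gradient_sq hμ hw).const_mul (3 / 4 * η)
    rw [integral_map hc.measurable.aemeasurable hgc.aestronglyMeasurable, dissipation,
      ← integral_const_mul, ← integral_sub (h.integrable_tilt hμ w) hg2]
    refine integral_mono hint ((h.integrable_tilt hμ w).sub hg2) fun θ => ?_
    have h1 := (abs_le.1 ((h.gradientLipschitz_tilt hw).abs_taylor_le
      (h.differentiable_tilt w) hH.le θ (transport R Φ V η μ θ))).2
    rw [transport_sub, inner_neg_right, real_inner_smul_right, real_inner_self_eq_norm_sq,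
      norm_neg, norm_smul, mul_pow, Real.norm_eq_abs, sq_abs] at h1
    have h2 := mul_le_mul_of_nonneg_right hηH
      (mul_nonneg hη (sq_nonneg ‖gradient (tilt Φ V w) θ‖))
    simp only
    linarith
  linarith

lemma objective_discreteStep_le (h : Landscape R Φ V M_R C_R B_Φ C_Φ b_V B_V C_V)
    (hμ : IsAdmissible μ) {σ : ℝ} (hη : 0 ≤ η) (hσ : 0 ≤ σ) (hp1 : η * σ ≤ 1)
    (hηH : η * (4 * smoothness k M_R C_Φ C_V) ≤ 1)
    (hμM : secondMoment μ ≤ M) (hηM : η * (16 * C_R * k ^ 2 * C_Φ ^ 2 * M) ≤ 1) :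
    objective R Φ V (discreteStep R Φ V η σ μ) ≤
      objective R Φ V μ - η / 2 * dissipation R Φ V μ
        + η * σ * objective R Φ V (uniformSphere n) := by
  have hp0 : 0 ≤ η * σ := mul_nonneg hη hσ
  have hν := h.isAdmissible_transport hμ η
  have h1 := h.objective_mixture_le hν (isAdmissible_uniformSphere h.n_pos) hp0 hp1
  have h2 := h.objective_transport_le hμ hη hηH hμM hηM
  have h3 := mul_nonneg hp0 (h.objective_nonneg hν)
  rw [discreteStep_eq]
  unfold mixture at h1
  linarith

lemma objective_uniformSphere_le (h : Landscape R Φ V M_R C_R B_Φ C_Φ b_V B_V C_V)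
    (hμ : IsAdmissible μ) (hμM : secondMoment μ ≤ M) :
    objective R Φ V (uniformSphere n) ≤ objective R Φ V μ + M_R * B_Φ * (M + 1) + B_V := by
  have hU := isAdmissible_uniformSphere h.n_pos
  have hsm := secondMoment_uniformSphere h.n_pos
  have h1 := h.loss.lipschitz (meanFeature Φ μ) (meanFeature Φ (uniformSphere n))
  have h2 := h.norm_meanFeature_le hU
  have h3 := h.norm_meanFeature_le hμ
  rw [hsm] at h2
  have h4 : ‖meanFeature Φ (uniformSphere n) - meanFeature Φ μ‖ ≤ B_Φ * (M + 1) := by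
    have := norm_sub_le (meanFeature Φ (uniformSphere n)) (meanFeature Φ μ)
    have := mul_le_mul_of_nonneg_left hμM h.B_Φ_nonneg
    linarith
  have h5 := mul_le_mul_of_nonneg_left h4 h.loss.M_nonneg
  have h6 : ∫ θ, V θ ∂(uniformSphere n) ≤ B_V := by
    have := integral_mono (h.integrable_potential hU) (hU.secondMoment.const_mul B_V)
      h.potential_le
    rw [integral_const_mul] at this
    rw [secondMoment] at hsm
    rwa [hsm, mul_one] at this
  have h7 : 0 ≤ ∫ θ, V θ ∂μ := integral_nonneg fun θ =>
    (mul_nonneg h.b_pos.le (sq_nonneg _)).trans (h.le_potential θ)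
  simp only [objective, meanFeature] at *
  linarith

/-- One step changes the tilted potential on the unit sphere by little, when the dissipation and
the noise are small. -/
lemma abs_tilt_discreteStep_sub_le (h : Landscape R Φ V M_R C_R B_Φ C_Φ b_V B_V C_V)
    (hμ : IsAdmissible μ) {σ : ℝ} (hη : 0 ≤ η) (hσ : 0 ≤ σ) (hp1 : η * σ ≤ 1)
    (hηH : η * (4 * smoothness k M_R C_Φ C_V) ≤ 1)
    (hM : 0 ≤ M) (hμM : objective R Φ V μ ≤ b_V * M)
    (hηM : η * (16 * C_R * k ^ 2 * C_Φ ^ 2 * M) ≤ 1) (θ : E n) :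
    |tilt Φ V (lossGradient R Φ (discreteStep R Φ V η σ μ)) θ
        - tilt Φ V (lossGradient R Φ μ) θ| ≤
      (2 * k * C_Φ * B_Φ * C_R * (M + 1) * (η * √(dissipation R Φ V μ))
        + η * σ * (C_R * B_Φ ^ 2 * (M + 1))) * ‖θ‖ ^ 2 := by
  have hp0 : 0 ≤ η * σ := mul_nonneg hη hσ
  have hH := h.smoothness_pos
  have hB := h.B_Φ_nonneg
  have hC := h.C_Φ_nonneg
  have hCR := h.loss.C_nonneg
  have hν := h.isAdmissible_transport hμ η
  have hU := isAdmissible_uniformSphere h.n_pos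
  have hμ2 := h.secondMoment_le_of_objective_le hμ hμM
  have hD := dissipation_nonneg R Φ V μ
  have hν2 : secondMoment (μ.map (transport R Φ V η μ)) ≤ M := by
    refine h.secondMoment_le_of_objective_le hν ?_
    have := h.objective_transport_le hμ hη hηH hμ2 hηM
    have : 0 ≤ η / 2 * dissipation R Φ V μ := by positivity
    linarith
  set ν := μ.map (transport R Φ V η μ) with hνdef
  have hmf : meanFeature Φ (discreteStep R Φ V η σ μ) - meanFeature Φ μ =
      (meanFeature Φ ν - meanFeature Φ μ)
        + (η * σ) • (meanFeature Φ (uniformSphere n) - meanFeature Φ ν) := by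
    have := h.meanFeature_mixture hν hU hp0 hp1
    rw [mixture] at this
    rw [discreteStep_eq, this]
    module
  have h1 : ‖meanFeature Φ ν - meanFeature Φ μ‖ ≤
      2 * k * C_Φ * (M + 1) * (η * √(dissipation R Φ V μ)) := by
    refine (h.norm_meanFeature_transport_sub_le hμ hη (by nlinarith)).trans ?_
    have hs : √(secondMoment μ) ≤ M + 1 := Real.sqrt_le_iff.2 ⟨by positivity, by nlinarith⟩
    have := mul_le_mul_of_nonneg_left hs
      (by positivity : 0 ≤ 2 * k * C_Φ * η * √(dissipation R Φ V μ))
    linarith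
  have h2 : ‖meanFeature Φ (uniformSphere n) - meanFeature Φ ν‖ ≤ B_Φ * (M + 1) := by
    have h3 := h.norm_meanFeature_le hU
    have h4 := h.norm_meanFeature_le hν
    rw [secondMoment_uniformSphere h.n_pos] at h3
    have := norm_sub_le (meanFeature Φ (uniformSphere n)) (meanFeature Φ ν)
    have := mul_le_mul_of_nonneg_left hν2 hB
    linarith
  have h3 : ‖meanFeature Φ (discreteStep R Φ V η σ μ) - meanFeature Φ μ‖ ≤
      2 * k * C_Φ * (M + 1) * (η * √(dissipation R Φ V μ)) + η * σ * (B_Φ * (M + 1)) := by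
    rw [hmf]
    refine (norm_add_le _ _).trans (add_le_add h1 ?_)
    rw [norm_smul, Real.norm_eq_abs, abs_of_nonneg hp0]
    exact mul_le_mul_of_nonneg_left h2 hp0
  refine (h.abs_tilt_sub_le _ _ θ).trans (mul_le_mul_of_nonneg_right ?_ (sq_nonneg _))
  have h4 : ‖lossGradient R Φ (discreteStep R Φ V η σ μ) - lossGradient R Φ μ‖ ≤ _ :=
    h.loss.gradientLipschitz _ _
  have h5 := mul_le_mul_of_nonneg_left (h4.trans (mul_le_mul_of_nonneg_left h3 hCR)) hB
  linarith

end Landscape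

/-! ### Exponential growth of the re-initialised mass -/

namespace Landscape

variable {n k : ℕ} {R : E k → ℝ} {Φ : E n → E k} {V : E n → ℝ}
  {M_R C_R B_Φ C_Φ b_V B_V C_V : ℝ}

/-- A direction with `g < 0` is surrounded by a whole cone of such directions, which carries an
amount of uniform mass that is exponentially small in the dimension only. -/
lemma pow_le_uniformSphere_descent_cone (h : Landscape R Φ V M_R C_R B_Φ C_Φ b_V B_V C_V)
    {w : E k} (hw : ‖w‖ ≤ M_R) {τ τ' : ℝ} (hτ' : 0 < τ') (hττ' : τ' ≤ τ) {θ₁ : E n}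
    (hθ₁ : ‖θ₁‖ = 1) (hneg : tilt Φ V w θ₁ ≤ -τ) :
    (τ' / (32 * smoothness k M_R C_Φ C_V)) ^ n ≤
      (uniformSphere n).real {θ | tilt Φ V w θ ≤ -(τ / 2) * ‖θ‖ ^ 2} := by
  set H := smoothness k M_R C_Φ C_V with hHdef
  have hH : 0 < H := h.smoothness_pos
  have hd := h.differentiable_tilt w
  have hom := h.hom_tilt w
  set g := tilt Φ V w with hg
  set r := τ' / (32 * H) with hr
  have hr0 : 0 < r := by positivity
  have hHr : H * r = τ' / 32 := by rw [hr]; field_simp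
  have hτH : 2 * τ ≤ H := by
    have h1 := (abs_le.1 (abs_real_inner_le_norm (gradient g θ₁) θ₁)).1
    have h2 := h.norm_gradient_tilt_le hw θ₁
    rw [hom.inner_gradient_self hd, hθ₁] at h1
    rw [hθ₁] at h2
    linarith
  have hr1 : r ≤ 1 / 64 := by
    rw [hr, div_le_iff₀ (by positivity)]
    linarith
  refine pow_le_uniformSphere_real h.n_pos (θ₀ := (1 / 2 : ℝ) • θ₁) ?_ ?_ hr0.le ?_
  · exact measurableSet_le hd.continuous.measurable
      ((measurable_norm.pow_const 2).const_mul _)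
  · intro c hc θ hθ
    simp only [mem_ofPred_eq] at hθ ⊢
    rw [hom c hc θ, smul_eq_mul, norm_smul, Real.norm_eq_abs, mul_pow, sq_abs]
    have := mul_le_mul_of_nonneg_left hθ (sq_nonneg c)
    linarith
  · intro θ hθ
    rw [Metric.mem_ball, dist_eq_norm] at hθ
    have hn0 : ‖(1 / 2 : ℝ) • θ₁‖ = 1 / 2 := by rw [norm_smul, hθ₁]; norm_num
    have hup : ‖θ‖ ≤ 1 / 2 + r := by
      have := norm_sub_norm_le θ ((1 / 2 : ℝ) • θ₁)
      linarith
    have hlo : 1 / 2 - r ≤ ‖θ‖ := by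
      have := norm_sub_norm_le ((1 / 2 : ℝ) • θ₁) θ
      rw [norm_sub_rev] at this
      linarith
    refine ⟨norm_pos_iff.1 (by linarith), by linarith, ?_⟩
    have h1 := (abs_le.1 ((h.gradientLipschitz_tilt hw).abs_taylor_le hd hH.le
      ((1 / 2 : ℝ) • θ₁) θ)).2
    have h2 := real_inner_le_norm (gradient g ((1 / 2 : ℝ) • θ₁)) (θ - (1 / 2 : ℝ) • θ₁)
    have h3 := h.norm_gradient_tilt_le hw ((1 / 2 : ℝ) • θ₁)
    rw [hn0] at h3
    have h4 : ‖gradient g ((1 / 2 : ℝ) • θ₁)‖ * ‖θ - (1 / 2 : ℝ) • θ₁‖ ≤ H * (1 / 2) * r :=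
      mul_le_mul h3 hθ.le (norm_nonneg _) (by positivity)
    have h5 : H * ‖θ - (1 / 2 : ℝ) • θ₁‖ ^ 2 ≤ H * (r * r) := by
      rw [sq]
      exact mul_le_mul_of_nonneg_left
        (mul_le_mul hθ.le hθ.le (norm_nonneg _) hr0.le) hH.le
    have h6 : H * (r * r) ≤ H * r * (1 / 64) := by
      rw [← mul_assoc]; exact mul_le_mul_of_nonneg_left hr1 (by positivity)
    have h7 : g ((1 / 2 : ℝ) • θ₁) ≤ -(τ / 4) := by
      rw [hom _ (by norm_num), smul_eq_mul]; linarith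
    have h8 : ‖θ‖ ^ 2 ≤ (1 / 2 + 1 / 64) ^ 2 :=
      pow_le_pow_left₀ (norm_nonneg _) (by linarith) 2
    have h9 : τ / 2 * ‖θ‖ ^ 2 ≤ τ / 2 * (1 / 2 + 1 / 64) ^ 2 :=
      mul_le_mul_of_nonneg_left h8 (by linarith)
    simp only [mem_ofPred_eq]
    norm_num at h9
    linarith

/-- Suppose that the first variation at time `0` is at most `-τ` somewhere on the sphere and moves
by at most `τ / 4` up to time `j + 1`.  Then the mass injected at time `1` into the cone of descent
directions grows exponentially: the sets `{‖θ‖ ≥ (1 + η τ' / 2) ^ i, g ≤ -γ ‖θ‖²}` are mapped into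
one another by `power_step`, so the second moment at time `j + 1` is exponentially large. -/
lemma mass_growth_le_secondMoment (h : Landscape R Φ V M_R C_R B_Φ C_Φ b_V B_V C_V)
    {η σ : ℝ} (hη : 0 < η) (hσ : 0 ≤ σ) (hp1 : η * σ ≤ 1)
    (hηH : η * (4 * smoothness k M_R C_Φ C_V) ≤ 1)
    {ρ : ℕ → Measure (E n)} (hρ : ∀ t, IsAdmissible (ρ t))
    (hstep : ∀ t, ρ (t + 1) = discreteStep R Φ V η σ (ρ t))
    {τ τ' : ℝ} (hτ' : 0 < τ') (hττ' : τ' ≤ τ) {θ₁ : E n} (hθ₁ : ‖θ₁‖ = 1)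
    (hneg : tilt Φ V (lossGradient R Φ (ρ 0)) θ₁ ≤ -τ) {j : ℕ} {κ : ℕ → ℝ}
    (hκ0 : ∀ t, 0 ≤ κ t)
    (hκ : ∀ t ≤ j, ∀ θ, |tilt Φ V (lossGradient R Φ (ρ (t + 1))) θ
      - tilt Φ V (lossGradient R Φ (ρ t)) θ| ≤ κ t * ‖θ‖ ^ 2)
    (hsum : ∑ t ∈ Finset.range (j + 1), κ t ≤ τ / 4) :
    (1 - η * σ) ^ j * (η * σ * (τ' / (32 * smoothness k M_R C_Φ C_V)) ^ n)
      * ((1 + η * τ' / 2) ^ j) ^ 2 ≤ secondMoment (ρ (j + 1)) := by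
  have hH := h.smoothness_pos
  have hp0 : 0 ≤ η * σ := mul_nonneg hη.le hσ
  set m := η * σ * (τ' / (32 * smoothness k M_R C_Φ C_V)) ^ n with hm
  set G : ℕ → E n → ℝ := fun t => tilt Φ V (lossGradient R Φ (ρ t)) with hG
  set γ : ℕ → ℝ := fun i => τ / 2 - ∑ t ∈ Finset.range (i + 1), κ t with hγdef
  set S : ℕ → Set (E n) := fun i =>
    {θ | (1 + η * τ' / 2) ^ i ≤ ‖θ‖ ∧ G (i + 1) θ ≤ -γ i * ‖θ‖ ^ 2} with hS
  have hγ : ∀ i ≤ j, τ / 4 ≤ γ i := by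
    intro i hi
    have : ∑ t ∈ Finset.range (i + 1), κ t ≤ ∑ t ∈ Finset.range (j + 1), κ t :=
      Finset.sum_le_sum_of_subset_of_nonneg (Finset.range_mono (by omega)) fun t _ _ => hκ0 t
    simp only [hγdef]
    linarith
  have hSmeas : ∀ i, MeasurableSet (S i) := fun i =>
    (measurableSet_le measurable_const measurable_norm).inter
      (measurableSet_le (h.differentiable_tilt _).continuous.measurable
        ((measurable_norm.pow_const 2).const_mul _))
  have hreal : ∀ t A, (ρ (t + 1)).real A =
      (1 - η * σ) * ((ρ t).map (transport R Φ V η (ρ t))).real A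
        + η * σ * (uniformSphere n).real A := fun t A => by
    have := (h.isAdmissible_transport (hρ t) η).prob
    have := isProbabilityMeasure_uniformSphere h.n_pos
    rw [hstep, discreteStep_eq]
    exact mixture_real_apply hp0 hp1 A
  have hmass : ∀ i ≤ j, (1 - η * σ) ^ i * m ≤ (ρ (i + 1)).real (S i) := by
    intro i
    induction i with
    | zero =>
      intro _
      have hcone := h.pow_le_uniformSphere_descent_cone (h.norm_lossGradient_le (ρ 0))
        hτ' hττ' hθ₁ hneg
      have hprob := isProbabilityMeasure_uniformSphere h.n_pos
      have hle : (uniformSphere n).real {θ | G 0 θ ≤ -(τ / 2) * ‖θ‖ ^ 2} ≤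
          (uniformSphere n).real (S 0) := by
        refine ENNReal.toReal_mono (measure_ne_top _ _) (measure_mono_ae ?_)
        filter_upwards [ae_uniformSphere_norm_eq_one] with θ hθ hG0
        have hG0' : G 0 θ ≤ -(τ / 2) * ‖θ‖ ^ 2 := hG0
        have h1 := (abs_le.1 (hκ 0 (Nat.zero_le _) θ)).2
        refine ⟨by simp [hθ], ?_⟩
        simp only [hγdef, Finset.sum_range_one, zero_add]
        simp only [hG, zero_add] at h1 hG0' ⊢
        linarith
      rw [hreal 0 (S 0), pow_zero, one_mul, hm]
      have h1 := mul_le_mul_of_nonneg_left (hcone.trans hle) hp0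
      have h2 : 0 ≤ (1 - η * σ) * ((ρ 0).map (transport R Φ V η (ρ 0))).real (S 0) :=
        mul_nonneg (sub_nonneg.2 hp1) measureReal_nonneg
      linarith
    | succ i ih =>
      intro hij
      have hih := ih (by omega)
      have hγi := hγ i (by omega)
      have hw := h.norm_lossGradient_le (ρ (i + 1))
      have hmaps : S i ⊆ transport R Φ V η (ρ (i + 1)) ⁻¹' S (i + 1) := by
        rintro θ ⟨hθ1, hθ2⟩
        obtain ⟨h1, h2⟩ := power_step (h.differentiable_tilt _) (h.hom_tilt _)
          (h.gradientLipschitz_tilt hw) hH.le hη (by linarith) (by linarith) hθ2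
        have hκi := (abs_le.1 (hκ (i + 1) hij (transport R Φ V η (ρ (i + 1)) θ))).2
        have hγs : γ (i + 1) = γ i - κ (i + 1) := by
          simp only [hγdef]
          rw [Finset.sum_range_succ _ (i + 1)]
          ring
        refine ⟨?_, ?_⟩
        · refine le_trans ?_ h2
          rw [pow_succ, mul_comm]
          refine mul_le_mul ?_ hθ1 (by positivity) ?_
          · have : η * τ' ≤ η * (4 * γ i) := mul_le_mul_of_nonneg_left (by linarith) hη.le
            linarith
          · have : 0 ≤ η * γ i := mul_nonneg hη.le (by linarith)
            linarith
        · change G (i + 1) (transport R Φ V η (ρ (i + 1)) θ) ≤ _ at h1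
          rw [hγs]
          simp only [hG] at h1 ⊢
          unfold transport at h1 hκi ⊢
          linarith
      have hprob := (hρ (i + 1)).prob
      have hle : (ρ (i + 1)).real (S i) ≤
          ((ρ (i + 1)).map (transport R Φ V η (ρ (i + 1)))).real (S (i + 1)) := by
        rw [map_measureReal_apply (h.continuous_transport _ _).measurable (hSmeas _)]
        exact measureReal_mono hmaps
      rw [hreal (i + 1) (S (i + 1)), pow_succ]
      have h1 := mul_le_mul_of_nonneg_left (hih.trans hle) (sub_nonneg.2 hp1)
      have h2 : 0 ≤ η * σ * (uniformSphere n).real (S (i + 1)) :=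
        mul_nonneg hp0 measureReal_nonneg
      linarith
  have hprob := (hρ (j + 1)).prob
  have hmarkov := mul_meas_ge_le_integral_of_nonneg (μ := ρ (j + 1))
    (f := fun θ => ‖θ‖ ^ 2) (Filter.Eventually.of_forall fun θ => sq_nonneg _)
    (hρ (j + 1)).secondMoment (((1 + η * τ' / 2) ^ j) ^ 2)
  have hsub : (ρ (j + 1)).real (S j) ≤
      (ρ (j + 1)).real {θ | ((1 + η * τ' / 2) ^ j) ^ 2 ≤ ‖θ‖ ^ 2} :=
    measureReal_mono fun θ hθ => pow_le_pow_left₀ (by positivity) hθ.1 2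
  calc _ = ((1 + η * τ' / 2) ^ j) ^ 2 * ((1 - η * σ) ^ j * m) := by ring
    _ ≤ ((1 + η * τ' / 2) ^ j) ^ 2 * _ :=
        mul_le_mul_of_nonneg_left ((hmass j le_rfl).trans hsub) (by positivity)
    _ ≤ _ := hmarkov

end Landscape

/-! ### Decrease of the objective over windows of fixed length -/

lemma discreteFlow_add {n k : ℕ} (R : E k → ℝ) (Φ : E n → E k) (V : E n → ℝ) (η σ : ℝ)
    (ρ₀ : Measure (E n)) (s t : ℕ) :
    discreteFlow R Φ V η σ ρ₀ (s + (t + 1)) =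
      discreteStep R Φ V η σ (discreteFlow R Φ V η σ ρ₀ (s + t)) := rfl

/-- A positive sequence with `a (i + 1) ≤ a i - q (a i)²` decays like `1 / (q i)`. -/
lemma mul_mul_le_one_of_quadratic_decrease {a : ℕ → ℝ} {q : ℝ} (hq : 0 ≤ q) {J : ℕ}
    (hpos : ∀ i ≤ J, 0 < a i) (hdec : ∀ i < J, a (i + 1) ≤ a i - q * a i ^ 2) :
    ∀ i ≤ J, i * q * a i ≤ 1 := by
  intro i
  induction i with
  | zero => simp
  | succ i ih =>
    intro hi
    have h1 := ih (by omega)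
    have h2 := hdec i (by omega)
    have h3 := hpos (i + 1) hi
    have h4 := hpos i (by omega)
    set x := q * a i with hx
    have hx0 : 0 ≤ x := mul_nonneg hq h4.le
    have hx1 : 0 ≤ 1 - x := by
      have h5 : 0 ≤ a i * (1 - x) := by rw [hx]; linarith
      exact nonneg_of_mul_nonneg_right h5 h4
    push_cast
    calc (i + 1 : ℝ) * q * a (i + 1) ≤ (i + 1 : ℝ) * q * (a i - q * a i ^ 2) :=
          mul_le_mul_of_nonneg_left h2 (by positivity)
      _ = (i * q * a i + x) * (1 - x) := by rw [hx]; ring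
      _ ≤ (1 + x) * (1 - x) := mul_le_mul_of_nonneg_right (by linarith) hx1
      _ ≤ 1 := by linarith [mul_nonneg hx0 hx0]

namespace Landscape

variable {n k : ℕ} {R : E k → ℝ} {Φ : E n → E k} {V : E n → ℝ}
  {M_R C_R B_Φ C_Φ b_V B_V C_V : ℝ}

/-- Over a window long enough for the re-initialised mass to outgrow the second moment bound `M`,
the total dissipation is at least of the order of the squared optimality gap at its start:
otherwise the first variation would hardly move, and the mass would grow until it contradicts
that bound. -/
lemma gap_sq_le_sum_dissipation (h : Landscape R Φ V M_R C_R B_Φ C_Φ b_V B_V C_V)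
    {η σ : ℝ} (hη : 0 < η) (hσ : 0 ≤ σ) (hp1 : η * σ ≤ 1)
    (hηH : η * (4 * smoothness k M_R C_Φ C_V) ≤ 1) {M : ℝ} (hM : 0 < M)
    (hηM : η * (16 * C_R * k ^ 2 * C_Φ ^ 2 * M) ≤ 1)
    {ρ : ℕ → Measure (E n)} (hρ : ∀ t, IsAdmissible (ρ t))
    (hstep : ∀ t, ρ (t + 1) = discreteStep R Φ V η σ (ρ t)) {j : ℕ}
    (hbound : ∀ t ≤ j + 1, objective R Φ V (ρ t) ≤ b_V * M)
    {ε Δ : ℝ} (hε : 0 < ε) (hεΔ : ε ≤ Δ)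
    (hgap : Δ ≤ objective R Φ V (ρ 0) - optimalValue R Φ V)
    {A A' c : ℝ} (hA : A = 2 * k * C_Φ * B_Φ * C_R * (M + 1))
    (hA' : A' = C_R * B_Φ ^ 2 * (M + 1))
    (hcA : c * ((64 * M) ^ 2 * A ^ 2) ≤ 1) (hcM : c * (4 * M) ≤ η ^ 2)
    (hnoise : (j + 1 : ℝ) * (η * σ * A') ≤ ε / (64 * M))
    (hgrow : M < (1 - η * σ) ^ j *
      (η * σ * (ε / (8 * M) / (32 * smoothness k M_R C_Φ C_V)) ^ n)
        * ((1 + η * (ε / (8 * M)) / 2) ^ j) ^ 2) :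
    c * Δ ^ 2 ≤ η * (j + 1) * (η * ∑ t ∈ Finset.range (j + 1), dissipation R Φ V (ρ t)) := by
  by_contra hcon
  push Not at hcon
  have hΔ : 0 < Δ := hε.trans_le hεΔ
  have hD : ∀ t, 0 ≤ dissipation R Φ V (ρ t) := fun t => dissipation_nonneg R Φ V _
  have hB := h.B_Φ_nonneg
  have hC := h.C_Φ_nonneg
  have hCR := h.loss.C_nonneg
  have hA0 : 0 ≤ A := by rw [hA]; positivity
  have hA'0 : 0 ≤ A' := by rw [hA']; positivity
  set Dtot := ∑ t ∈ Finset.range (j + 1), dissipation R Φ V (ρ t) with hsum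
  have hDtot0 : 0 ≤ Dtot := Finset.sum_nonneg fun t _ => hD t
  have hD0 : dissipation R Φ V (ρ 0) ≤ Dtot :=
    Finset.single_le_sum (f := fun t => dissipation R Φ V (ρ t)) (fun t _ => hD t)
      (Finset.mem_range.2 (Nat.succ_pos j))
  have hj : (1 : ℝ) ≤ j + 1 := by linarith [(Nat.cast_nonneg j : (0 : ℝ) ≤ j)]
  have hDgap : 4 * M * dissipation R Φ V (ρ 0) ≤ Δ ^ 2 := by
    have h1 : η ^ 2 * Dtot ≤ c * Δ ^ 2 := by
      have : η ^ 2 * Dtot * 1 ≤ η ^ 2 * Dtot * (j + 1) :=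
        mul_le_mul_of_nonneg_left hj (by positivity)
      linarith
    have h2 : η ^ 2 * (4 * M * dissipation R Φ V (ρ 0)) ≤ η ^ 2 * Δ ^ 2 := by
      have h3 := mul_le_mul_of_nonneg_left hD0 (by positivity : 0 ≤ η ^ 2 * (4 * M))
      have h4 := mul_le_mul_of_nonneg_left h1 (by positivity : 0 ≤ 4 * M)
      have h5 := mul_le_mul_of_nonneg_right hcM (sq_nonneg Δ)
      linarith
    exact le_of_mul_le_mul_left h2 (by positivity)
  obtain ⟨θ₁, hθ₁, hneg⟩ := h.exists_descent_direction (hρ 0) hM (hbound 0 (Nat.zero_le _)) hΔ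
    hgap hDgap
  have hdrift : ∑ t ∈ Finset.range (j + 1), (A * (η * √(dissipation R Φ V (ρ t))) + η * σ * A')
      ≤ Δ / (8 * M) / 4 := by
    have h1 : A * η * ∑ t ∈ Finset.range (j + 1), √(dissipation R Φ V (ρ t)) ≤ Δ / (64 * M) := by
      refine le_of_sq_le_sq ?_ (by positivity)
      have h2 : (∑ t ∈ Finset.range (j + 1), √(dissipation R Φ V (ρ t))) ^ 2 ≤ (j + 1) * Dtot := by
        have := sq_sum_le_card_mul_sum_sq (s := Finset.range (j + 1))
          (f := fun t => √(dissipation R Φ V (ρ t)))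
        rw [Finset.card_range, Finset.sum_congr rfl fun t _ => Real.sq_sqrt (hD t)] at this
        exact_mod_cast this
      have h3 := mul_le_mul_of_nonneg_left h2 (by positivity : 0 ≤ (A * η) ^ 2)
      have h4 := mul_le_mul_of_nonneg_left hcon.le (sq_nonneg A)
      have h5 := mul_le_mul_of_nonneg_right hcA (sq_nonneg Δ)
      rw [div_pow, le_div_iff₀ (by positivity), mul_pow]
      have h6 : (A * η) ^ 2 * (∑ t ∈ Finset.range (j + 1), √(dissipation R Φ V (ρ t))) ^ 2 ≤
          A ^ 2 * (c * Δ ^ 2) := by linarith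
      have h7 := mul_le_mul_of_nonneg_right h6 (by positivity : 0 ≤ (64 * M) ^ 2)
      linarith
    have h2 : ε / (64 * M) ≤ Δ / (64 * M) := by gcongr
    have h3 : Δ / (8 * M) / 4 = Δ / (64 * M) + Δ / (64 * M) := by field_simp; norm_num
    rw [Finset.sum_add_distrib, Finset.sum_const, Finset.card_range, nsmul_eq_mul,
      ← Finset.mul_sum, ← Finset.mul_sum, h3]
    push_cast
    linarith
  have hmom := h.mass_growth_le_secondMoment hη hσ hp1 hηH hρ hstep (τ := Δ / (8 * M))
    (τ' := ε / (8 * M)) (by positivity) (by gcongr) hθ₁ hneg (j := j)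
    (κ := fun t => A * (η * √(dissipation R Φ V (ρ t))) + η * σ * A')
    (fun t => by positivity) (fun t ht θ => by
      rw [hstep, hA, hA']
      exact h.abs_tilt_discreteStep_sub_le (hρ t) hη.le hσ hp1 hηH hM.le
        (hbound t (by omega)) hηM θ) hdrift
  have := h.secondMoment_le_of_objective_le (hρ (j + 1)) (hbound (j + 1) le_rfl)
  linarith

/-- Convergence, given step sizes for which the noise is strong enough to make its mass outgrow
the second moment bound within a window, and weak enough not to spoil the descent. -/
lemma exists_near_optimal (h : Landscape R Φ V M_R C_R B_Φ C_Φ b_V B_V C_V)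
    {ρ₀ : Measure (E n)} (hρ₀ : IsAdmissible ρ₀)
    {η σ : ℝ} (hη : 0 < η) (hσ : 0 ≤ σ) (hp1 : η * σ ≤ 1)
    (hηH : η * (4 * smoothness k M_R C_Φ C_V) ≤ 1) {M : ℝ} (hM : 0 < M)
    (hMb : objective R Φ V ρ₀ + 1 ≤ b_V * M)
    (hηM : η * (16 * C_R * k ^ 2 * C_Φ ^ 2 * M) ≤ 1)
    {ε : ℝ} (hε : 0 < ε)
    {A A' c K : ℝ} (hA : A = 2 * k * C_Φ * B_Φ * C_R * (M + 1))
    (hA' : A' = C_R * B_Φ ^ 2 * (M + 1)) (hc : 0 < c)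
    (hK : objective R Φ V (uniformSphere n) ≤ K)
    (hcA : c * ((64 * M) ^ 2 * A ^ 2) ≤ 1) (hcM : c * (4 * M) ≤ η ^ 2) {j J : ℕ}
    (hnoise : (j + 1 : ℝ) * (η * σ * A') ≤ ε / (64 * M))
    (hgrow : M < (1 - η * σ) ^ j *
      (η * σ * (ε / (8 * M) / (32 * smoothness k M_R C_Φ C_V)) ^ n)
        * ((1 + η * (ε / (8 * M)) / 2) ^ j) ^ 2)
    (hwindow : (j + 1 : ℝ) * (η * σ * K) * (4 * η * (j + 1)) ≤ c * ε ^ 2)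
    (htotal : (J * (j + 1) : ℝ) * (η * σ * K) ≤ 1)
    (hJ : 4 * η * (j + 1) ≤ J * (c * ε)) :
    ∃ t : ℕ, t ≤ J * (j + 1) ∧
      objective R Φ V (discreteFlow R Φ V η σ ρ₀ t) - optimalValue R Φ V ≤ ε := by
  by_contra hcon
  push Not at hcon
  set ρ := discreteFlow R Φ V η σ ρ₀ with hρdef
  have hp0 : 0 ≤ η * σ := mul_nonneg hη.le hσ
  have hK0 : 0 ≤ K := (h.objective_nonneg (isAdmissible_uniformSphere h.n_pos)).trans hK
  have hstep : ∀ t, ρ (t + 1) = discreteStep R Φ V η σ (ρ t) := fun t => rfl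
  have hρ : ∀ t, IsAdmissible (ρ t) := fun t => by
    induction t with
    | zero => exact hρ₀
    | succ t ih => exact h.isAdmissible_discreteStep ih hp0 hp1
  have hdesc : ∀ t, objective R Φ V (ρ t) ≤ b_V * M →
      objective R Φ V (ρ (t + 1)) ≤
        objective R Φ V (ρ t) - η / 2 * dissipation R Φ V (ρ t) + η * σ * K := fun t ht => by
    have h1 := h.objective_discreteStep_le (hρ t) hη.le hσ hp1 hηH
      (h.secondMoment_le_of_objective_le (hρ t) ht) hηM
    have h2 := mul_le_mul_of_nonneg_left hK hp0
    rw [hstep]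
    linarith
  have hbound' : ∀ t ≤ J * (j + 1),
      objective R Φ V (ρ t) ≤ objective R Φ V ρ₀ + t * (η * σ * K) ∧
        objective R Φ V (ρ t) ≤ b_V * M := fun t => by
    induction t with
    | zero =>
      intro _
      have : ρ 0 = ρ₀ := rfl
      rw [this]
      constructor
      · simp
      · linarith
    | succ t ih =>
      intro ht
      obtain ⟨ih1, ih2⟩ := ih (by omega)
      have h1 := hdesc t ih2
      have h2 : 0 ≤ η / 2 * dissipation R Φ V (ρ t) :=
        mul_nonneg (by positivity) (dissipation_nonneg R Φ V _)
      have h3 : objective R Φ V (ρ (t + 1)) ≤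
          objective R Φ V ρ₀ + ((t + 1 : ℕ) : ℝ) * (η * σ * K) := by
        push_cast
        linarith
      refine ⟨h3, h3.trans ?_⟩
      have h4 : ((t + 1 : ℕ) : ℝ) ≤ (J * (j + 1) : ℝ) := by exact_mod_cast ht
      have h5 := mul_le_mul_of_nonneg_right h4 (mul_nonneg hp0 hK0)
      linarith
  have hbound := fun t ht => (hbound' t ht).2
  have hsumdesc : ∀ s m, s + m ≤ J * (j + 1) → objective R Φ V (ρ (s + m)) ≤
      objective R Φ V (ρ s) - η / 2 * ∑ t ∈ Finset.range m, dissipation R Φ V (ρ (s + t))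
        + m * (η * σ * K) := fun s m => by
    induction m with
    | zero => simp
    | succ m ih =>
      intro hm
      have h1 := ih (by omega)
      have h2 := hdesc (s + m) (hbound _ (by omega))
      rw [Finset.sum_range_succ]
      push_cast
      rw [← add_assoc s m 1]
      linarith
  have hj0 : (0 : ℝ) < j + 1 := by positivity
  set q := c / (4 * η * (j + 1)) with hq
  have hq0 : 0 < q := by positivity
  set a : ℕ → ℝ := fun i => objective R Φ V (ρ (i * (j + 1))) - optimalValue R Φ V with ha
  have hapos : ∀ i ≤ J, ε < a i := fun i hi => hcon _ (Nat.mul_le_mul_right _ hi)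
  have hdec : ∀ i < J, a (i + 1) ≤ a i - q * a i ^ 2 := by
    intro i hi
    have hle : i * (j + 1) + (j + 1) ≤ J * (j + 1) := by
      rw [← Nat.succ_mul]; exact Nat.mul_le_mul_right _ hi
    have h1 := hsumdesc (i * (j + 1)) (j + 1) hle
    have hai := hapos i hi.le
    have h2 := h.gap_sq_le_sum_dissipation hη hσ hp1 hηH hM hηM
      (ρ := fun t => ρ (i * (j + 1) + t)) (fun t => hρ _)
      (fun t => discreteFlow_add R Φ V η σ ρ₀ _ t) (fun t ht => hbound _ (by omega)) hε hai.le
      (by simp [ha]) hA hA' hcA hcM hnoise hgrow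
    have h3 : q * a i ^ 2 * (4 * η * (j + 1)) = c * a i ^ 2 := by
      rw [hq]; field_simp
    have h4 : c * ε ^ 2 ≤ c * a i ^ 2 :=
      mul_le_mul_of_nonneg_left (pow_le_pow_left₀ hε.le hai.le 2) hc.le
    have h5 : (q * a i ^ 2) * (4 * η * (j + 1)) ≤
        (η / 2 * ∑ t ∈ Finset.range (j + 1), dissipation R Φ V (ρ (i * (j + 1) + t))
          - (j + 1) * (η * σ * K)) * (4 * η * (j + 1)) := by
      linarith
    have h6 := le_of_mul_le_mul_right h5 (by positivity)
    have h7 : (i + 1) * (j + 1) = i * (j + 1) + (j + 1) := by ring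
    push_cast at h1
    simp only [ha, h7] at h6 ⊢
    linarith
  have hfin := mul_mul_le_one_of_quadratic_decrease hq0.le
    (fun i hi => hε.trans (hapos i hi)) hdec J le_rfl
  have haJ := hapos J le_rfl
  have hJpos : (0 : ℝ) < J := by
    by_contra hneg
    have : (J : ℝ) = 0 := le_antisymm (not_lt.1 hneg) (Nat.cast_nonneg _)
    rw [this, zero_mul] at hJ
    have : 0 < 4 * η * (j + 1) := by positivity
    linarith
  have h1 : J * q * ε < J * q * a J := mul_lt_mul_of_pos_left haJ (by positivity)
  have h2 : 1 ≤ J * q * ε := by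
    rw [hq, mul_div_assoc', div_mul_eq_mul_div, le_div_iff₀ (by positivity)]
    linarith
  linarith

end Landscape

/-! ### Choice of the window length and of the noise level -/

lemma exp_half_le_one_add {x : ℝ} (hx0 : 0 ≤ x) (hx1 : x ≤ 1) : Real.exp (x / 2) ≤ 1 + x := by
  have h := Real.add_one_le_exp (-(x / 2))
  rw [Real.exp_neg] at h
  have hpos := Real.exp_pos (x / 2)
  have h1 : (1 - x / 2) * Real.exp (x / 2) ≤ 1 := by
    have := mul_le_mul_of_nonneg_right h hpos.le
    rw [inv_mul_cancel₀ hpos.ne'] at this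
    linarith
  have h2 : (1 - x / 2) * Real.exp (x / 2) ≤ (1 - x / 2) * (1 + x) := by
    nlinarith [mul_nonneg hx0 (sub_nonneg.2 hx1)]
  exact le_of_mul_le_mul_left h2 (by linarith)

/-- The noise level `exp (-y P)` beats every polynomial factor, including powers of `P` itself. -/
lemma exp_neg_mul_le_one {y ε P Q : ℝ} (hy : 1 / 2 ≤ y) (hε : 0 < ε) (hεy : 1 / ε ≤ Real.exp y)
    (hQ : 0 ≤ Q) (hP : 12 + 192 * Q ≤ P) :
    Real.exp (-(y * P)) * (y ^ 2 / ε ^ 4) * (P ^ 2 * Q) ≤ 1 := by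
  have hy0 : 0 ≤ y := by linarith
  have h1 : y ^ 2 / ε ^ 4 ≤ Real.exp (6 * y) := by
    have h2 : y ≤ Real.exp y := by linarith [Real.add_one_le_exp y]
    have h3 : y ^ 2 / ε ^ 4 = y ^ 2 * (1 / ε) ^ 4 := by rw [one_div, inv_pow]; rfl
    have h4 : Real.exp (6 * y) = Real.exp y ^ 2 * Real.exp y ^ 4 := by
      rw [← pow_add, ← Real.exp_nat_mul]; norm_num
    rw [h3, h4]
    exact mul_le_mul (pow_le_pow_left₀ hy0 h2 2)
      (pow_le_pow_left₀ (by positivity) hεy 4) (by positivity) (by positivity)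
  set x := P - 6 with hx
  have hx6 : 6 ≤ x := by linarith
  have h2 : P ^ 2 * Q ≤ Real.exp (y * x) := by
    have h3 : (x / 2) ^ 3 / (Nat.factorial 3 : ℕ) ≤ Real.exp (x / 2) :=
      Real.pow_div_factorial_le_exp (x / 2) (by linarith) 3
    have h4 : Real.exp (x / 2) ≤ Real.exp (y * x) := by
      apply Real.exp_le_exp.2
      linarith [mul_le_mul_of_nonneg_right hy (by linarith : 0 ≤ x)]
    have h5 : P ^ 2 ≤ (2 * x) ^ 2 := pow_le_pow_left₀ (by linarith) (by linarith) 2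
    have h6 := mul_le_mul_of_nonneg_right h5 hQ
    have h7 : x ^ 2 * (192 * Q) ≤ x ^ 2 * x :=
      mul_le_mul_of_nonneg_left (by linarith) (sq_nonneg x)
    norm_num [Nat.factorial] at h3
    linarith
  calc Real.exp (-(y * P)) * (y ^ 2 / ε ^ 4) * (P ^ 2 * Q)
      ≤ Real.exp (-(y * P)) * Real.exp (6 * y) * Real.exp (y * x) := by
        refine mul_le_mul (mul_le_mul_of_nonneg_left h1 (Real.exp_pos _).le) h2 ?_ (by positivity)
        positivity
    _ = 1 := by
      rw [← Real.exp_add, ← Real.exp_add, hx]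
      ring_nf
      exact Real.exp_zero

/-- A window of length `O(d log (1/ε) / ε)` suffices for the re-initialised mass to outgrow `M`. -/
lemma exists_window_length {d : ℕ} (hd : 1 ≤ d) {ε M H P₁ P σ : ℝ} (hε : 0 < ε)
    (hε2 : ε ≤ 1 / 2) (hM : 1 ≤ M) (hH : 0 < H) (hP₁ : 1 ≤ P₁) (hP : 0 ≤ P) {y B Q : ℝ}
    (hy : y = d * Real.log (1 / ε)) (hy2 : 1 / 2 ≤ y)
    (hσ : σ = Real.exp (-(y * P)))
    (hQ : Q = 4 * M + 2 * P₁ + 1024 * H * M + 2 + P) (hB : B = 16 * M * P₁ * Q + 4)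
    (hσB : B * (y / ε) * σ ≤ 1 / 2) :
    ∃ j : ℕ, (j + 1 : ℝ) ≤ B * (y / ε) ∧
      M < (1 - 1 / P₁ * σ) ^ j * (1 / P₁ * σ * (ε / (8 * M) / (32 * H)) ^ (d + 1))
        * ((1 + 1 / P₁ * (ε / (8 * M)) / 2) ^ j) ^ 2 := by
  have hM0 : 0 < M := by linarith
  have hP₁0 : 0 < P₁ := by linarith
  have hσ0 : 0 < σ := hσ ▸ Real.exp_pos _
  have hQ0 : 0 < Q := by rw [hQ]; positivity
  have hy0 : 0 < y := by linarith
  have hℓ : 1 / 2 ≤ Real.log (1 / ε) := by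
    have h1 : Real.log 2 ≤ Real.log (1 / ε) :=
      Real.log_le_log two_pos ((le_div_iff₀ hε).2 (by linarith))
    linarith [Real.log_two_gt_d9]
  have hyε : 1 ≤ y / ε := (le_div_iff₀ hε).2 (by linarith)
  set j := ⌈16 * M * P₁ * Q * (y / ε)⌉₊ with hj
  have hjlo : 16 * M * P₁ * Q * (y / ε) ≤ j := Nat.le_ceil _
  have hjup : (j + 1 : ℝ) ≤ B * (y / ε) := by
    have := (Nat.ceil_lt_add_one (by positivity : 0 ≤ 16 * M * P₁ * Q * (y / ε))).le
    rw [hB]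
    linarith
  refine ⟨j, hjup, ?_⟩
  have hη1 : 1 / P₁ ≤ 1 := by rw [div_le_one hP₁0]; exact hP₁
  have hη0 : 0 < 1 / P₁ := by positivity
  set η := 1 / P₁ with hη
  -- The mass lost to later re-initialisations is at most one half.
  have hloss : 1 / 2 ≤ (1 - η * σ) ^ j := by
    have hjσ : (j : ℝ) * (η * σ) ≤ 1 / 2 := by
      have h1 : (j : ℝ) * σ ≤ B * (y / ε) * σ :=
        mul_le_mul_of_nonneg_right (by linarith) hσ0.le
      have h2 : (j : ℝ) * σ * η ≤ (j : ℝ) * σ * 1 :=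
        mul_le_mul_of_nonneg_left hη1 (by positivity)
      linarith
    have hησ : η * σ ≤ 1 / 2 := by
      have h1 : σ ≤ B * (y / ε) * σ := by
        have : 1 ≤ B * (y / ε) := by linarith [(Nat.cast_nonneg j : (0 : ℝ) ≤ j)]
        exact le_mul_of_one_le_left hσ0.le this
      have h2 := mul_le_mul_of_nonneg_right hη1 hσ0.le
      linarith
    have := one_add_mul_le_pow (a := -(η * σ)) (by linarith) j
    rw [← sub_eq_add_neg] at this
    linarith
  have hgrow : Real.exp (y * Q) ≤ ((1 + η * (ε / (8 * M)) / 2) ^ j) ^ 2 := by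
    set x := η * (ε / (8 * M)) / 2 with hx
    have hx0 : 0 ≤ x := by positivity
    have hτ : ε / (8 * M) ≤ 1 := by rw [div_le_one (by positivity)]; linarith
    have hx1 : x ≤ 1 := by
      have : η * (ε / (8 * M)) ≤ 1 * 1 := mul_le_mul hη1 hτ (by positivity) zero_le_one
      rw [hx]; linarith
    have h1 : Real.exp (x / 2) ^ (j * 2) ≤ (1 + x) ^ (j * 2) :=
      pow_le_pow_left₀ (Real.exp_pos _).le (exp_half_le_one_add hx0 hx1) _
    rw [← pow_mul]
    refine le_trans ?_ h1
    rw [← Real.exp_nat_mul]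
    apply Real.exp_le_exp.2
    have h2 : y * Q = 16 * M * P₁ * Q * (y / ε) * x := by
      rw [hx, hη]; field_simp; norm_num
    have h3 := mul_le_mul_of_nonneg_right hjlo hx0
    push_cast
    linarith
  have hn : ((d + 1 : ℕ) : ℝ) ≤ 2 * d := by
    have : (1 : ℝ) ≤ d := by exact_mod_cast hd
    push_cast; linarith
  have hn1 : ((d + 1 : ℕ) : ℝ) * Real.log (1 / ε) ≤ 2 * y := by
    rw [hy, ← mul_assoc]
    exact mul_le_mul_of_nonneg_right hn (by linarith)
  have hn2 : ((d + 1 : ℕ) : ℝ) ≤ 4 * y := by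
    have := mul_le_mul_of_nonneg_left hℓ (Nat.cast_nonneg d : (0 : ℝ) ≤ d)
    rw [← hy] at this
    linarith
  set z := 256 * H * M with hz
  have hz0 : 0 < z := by positivity
  -- Each factor of the injected mass is compensated by one summand of the exponent `y Q`.
  have hexp : Real.exp (2 * M) * (Real.exp P₁ * (Real.exp (y * P) *
      (Real.exp z ^ (d + 1) * (1 / ε) ^ (d + 1)))) ≤ Real.exp (y * Q) := by
    have h1 : (1 / ε) ^ (d + 1) = Real.exp (((d + 1 : ℕ) : ℝ) * Real.log (1 / ε)) := by
      rw [Real.exp_nat_mul, Real.exp_log (by positivity)]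
    rw [h1, ← Real.exp_nat_mul, ← Real.exp_add, ← Real.exp_add, ← Real.exp_add, ← Real.exp_add]
    apply Real.exp_le_exp.2
    have h2 := mul_le_mul_of_nonneg_right hn2 hz0.le
    have h3 : 2 * M ≤ y * (4 * M) := by
      linarith [mul_le_mul_of_nonneg_right hy2 (by positivity : 0 ≤ 4 * M)]
    have h4 : P₁ ≤ y * (2 * P₁) := by
      linarith [mul_le_mul_of_nonneg_right hy2 (by positivity : 0 ≤ 2 * P₁)]
    rw [hQ]
    rw [hz] at h2 ⊢
    linarith
  have hr : ε / (8 * M) / (32 * H) = ε / z := by rw [hz, div_div]; ring_nf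
  have hcancel : σ * Real.exp (y * P) = 1 := by
    rw [hσ, ← Real.exp_add, neg_add_cancel, Real.exp_zero]
  have hP₁exp : 1 ≤ η * Real.exp P₁ := by
    rw [hη, one_div_mul_eq_div, one_le_div hP₁0]
    linarith [Real.add_one_le_exp P₁]
  have hzexp : 1 ≤ (ε / z) ^ (d + 1) * (Real.exp z ^ (d + 1) * (1 / ε) ^ (d + 1)) := by
    rw [← mul_pow, ← mul_pow]
    apply one_le_pow₀
    have : ε / z * (Real.exp z * (1 / ε)) = Real.exp z / z := by field_simp
    rw [this, one_le_div hz0]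
    linarith [Real.add_one_le_exp z]
  rw [hr]
  have hinj : Real.exp (2 * M) ≤ η * σ * (ε / z) ^ (d + 1) * Real.exp (y * Q) := by
    have h1 := mul_le_mul_of_nonneg_left hexp
      (by positivity : 0 ≤ η * σ * (ε / z) ^ (d + 1))
    refine le_trans ?_ h1
    have h2 : 1 * 1 ≤ (η * Real.exp P₁) *
        ((ε / z) ^ (d + 1) * (Real.exp z ^ (d + 1) * (1 / ε) ^ (d + 1))) :=
      mul_le_mul hP₁exp hzexp zero_le_one (by positivity)
    calc Real.exp (2 * M) = Real.exp (2 * M) * (σ * Real.exp (y * P)) * (1 * 1) := by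
          rw [hcancel]; ring
      _ ≤ Real.exp (2 * M) * (σ * Real.exp (y * P)) * ((η * Real.exp P₁) *
          ((ε / z) ^ (d + 1) * (Real.exp z ^ (d + 1) * (1 / ε) ^ (d + 1)))) :=
          mul_le_mul_of_nonneg_left h2 (by positivity)
      _ = _ := by ring
  have h2M : 2 * M < Real.exp (2 * M) := by linarith [Real.add_one_le_exp (2 * M)]
  calc M < 1 / 2 * (η * σ * (ε / z) ^ (d + 1) * Real.exp (y * Q)) := by linarith
    _ ≤ (1 - η * σ) ^ j * (η * σ * (ε / z) ^ (d + 1)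
          * ((1 + η * (ε / (8 * M)) / 2) ^ j) ^ 2) := by
        refine mul_le_mul hloss (mul_le_mul_of_nonneg_left hgrow (by positivity))
          (by positivity) (by linarith)
    _ = _ := by ring

/-- Numbers `j + 1` and `J` of steps per window and of windows for which the noise is strong and
weak enough in the sense of `Landscape.exists_near_optimal`, with a total of `O(d² / ε⁴)` steps. -/
lemma exists_schedule {d : ℕ} (hd : 1 ≤ d) {ε M H P₁ P σ K W A' B₁ : ℝ} (hε : 0 < ε)
    (hε2 : ε ≤ 1 / 2) (hM : 1 ≤ M) (hH : 0 < H) (hP₁ : 1 ≤ P₁) (hK : 0 ≤ K) (hW : 1 ≤ W)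
    (hA' : 0 ≤ A') (hB₁ : B₁ = 16 * M * P₁ * (4 * M + 2 * P₁ + 1024 * H * M + 3) + 4)
    (hP : P = 12 + 192 * (B₁ ^ 2 * (4 + (4 * W + 1) * K + 128 * M * A' + 4 * W * K)))
    (hσ : σ = Real.exp (-(d * Real.log (1 / ε) * P))) :
    ∃ j J : ℕ, (j + 1 : ℝ) * (1 / P₁ * σ * A') ≤ ε / (64 * M) ∧
      M < (1 - 1 / P₁ * σ) ^ j * (1 / P₁ * σ * (ε / (8 * M) / (32 * H)) ^ (d + 1))
        * ((1 + 1 / P₁ * (ε / (8 * M)) / 2) ^ j) ^ 2 ∧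
      (j + 1 : ℝ) * (1 / P₁ * σ * K) * (4 * (1 / P₁) * (j + 1)) ≤ 1 / W * ε ^ 2 ∧
      (J * (j + 1) : ℝ) * (1 / P₁ * σ * K) ≤ 1 ∧
      4 * (1 / P₁) * (j + 1) ≤ J * (1 / W * ε) ∧
      (J * (j + 1) : ℝ) ≤ (d : ℝ) ^ 2 / ε ^ 4 * (4 * (4 * W + 1) * (B₁ * P) ^ 2) := by
  have hM0 : 0 < M := by linarith
  have hP₁0 : 0 < P₁ := by linarith
  have hW0 : 0 < W := by linarith
  have hσ0 : 0 < σ := hσ ▸ Real.exp_pos _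
  have hη1 : 1 / P₁ ≤ 1 := by rw [div_le_one hP₁0]; exact hP₁
  have hη0 : 0 < 1 / P₁ := by positivity
  have hB₁4 : 4 ≤ B₁ := by rw [hB₁]; linarith [(by positivity :
    0 ≤ 16 * M * P₁ * (4 * M + 2 * P₁ + 1024 * H * M + 3))]
  set G := 4 + (4 * W + 1) * K + 128 * M * A' + 4 * W * K with hG
  have hQ1 : 0 ≤ B₁ ^ 2 * G := by positivity
  have hP12 : 12 ≤ P := by rw [hP]; linarith
  have hd1 : (1 : ℝ) ≤ d := by exact_mod_cast hd
  set ℓ := Real.log (1 / ε) with hℓdef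
  have hℓ : 1 / 2 ≤ ℓ := by
    have h1 : Real.log 2 ≤ ℓ :=
      Real.log_le_log two_pos ((le_div_iff₀ hε).2 (by linarith))
    linarith [Real.log_two_gt_d9]
  have hexpℓ : Real.exp ℓ = 1 / ε := Real.exp_log (by positivity)
  set y := d * ℓ with hy
  have hℓy : ℓ ≤ y := le_mul_of_one_le_left (by linarith) hd1
  have hy2 : 1 / 2 ≤ y := hℓ.trans hℓy
  have hyε : 1 ≤ y / ε := (le_div_iff₀ hε).2 (by linarith)
  have hbase := exp_neg_mul_le_one hy2 hε (hexpℓ ▸ Real.exp_le_exp.2 hℓy) hQ1 hP.ge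
  rw [← hσ] at hbase
  -- `N` bounds the window length; the noise is negligible against `N²`.
  set N := B₁ * P * (y / ε) with hN
  have hN1 : 1 ≤ N := by
    have : 1 ≤ B₁ * P := one_le_mul_of_one_le_of_one_le (by linarith) (by linarith)
    exact one_le_mul_of_one_le_of_one_le this hyε
  have hsG : σ * N ^ 2 * G ≤ ε ^ 2 := by
    have h1 : σ * N ^ 2 * G = σ * (y ^ 2 / ε ^ 4) * (P ^ 2 * (B₁ ^ 2 * G)) * ε ^ 2 := by
      rw [hN]; field_simp
    rw [h1]
    exact mul_le_of_le_one_left (sq_nonneg ε) hbase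
  set s := σ * N ^ 2 with hs
  have hs0 : 0 ≤ s := by positivity
  have hpart : ∀ g, g ≤ G → s * g ≤ ε ^ 2 := fun g hg =>
    (mul_le_mul_of_nonneg_left hg hs0).trans hsG
  have hWK : 0 ≤ 4 * W * K := by positivity
  have hMA : 0 ≤ 128 * M * A' := by positivity
  have hWK1 : 0 ≤ (4 * W + 1) * K := by positivity
  have hs1 := hpart 4 (by linarith)
  have hs2 := hpart ((4 * W + 1) * K) (by linarith)
  have hs3 := hpart (128 * M * A') (by linarith)
  have hs4 := hpart (4 * W * K) (by linarith)
  have hεsq : ε ^ 2 ≤ ε / 2 := by nlinarith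
  have hσN : σ * N ≤ s := by
    rw [hs, sq]
    exact mul_le_mul_of_nonneg_left (le_mul_of_one_le_left (by linarith) hN1) hσ0.le
  obtain ⟨Q, hQ⟩ : ∃ Q, Q = 4 * M + 2 * P₁ + 1024 * H * M + 2 + P := ⟨_, rfl⟩
  obtain ⟨B, hB⟩ : ∃ B, B = 16 * M * P₁ * Q + 4 := ⟨_, rfl⟩
  have hBB₁ : B ≤ B₁ * P := by
    have h1 : Q ≤ (4 * M + 2 * P₁ + 1024 * H * M + 3) * P := by
      have h2 : (4 * M + 2 * P₁ + 1024 * H * M + 2) * 1 ≤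
          (4 * M + 2 * P₁ + 1024 * H * M + 2) * P :=
        mul_le_mul_of_nonneg_left (by linarith) (by positivity)
      rw [hQ]; linarith
    have h2 := mul_le_mul_of_nonneg_left h1 (by positivity : 0 ≤ 16 * M * P₁)
    rw [hB, hB₁]
    linarith
  have hBN : B * (y / ε) ≤ N := mul_le_mul_of_nonneg_right hBB₁ (by linarith)
  obtain ⟨j, hjB, hgrow⟩ := exists_window_length hd hε hε2 hM hH hP₁ (by linarith) hy hy2 hσ hQ hB
    (by linarith [mul_le_mul_of_nonneg_right hBN hσ0.le])
  set T : ℝ := j + 1 with hT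
  have hT1 : 1 ≤ T := by linarith [(Nat.cast_nonneg j : (0 : ℝ) ≤ j)]
  have hTN : T ≤ N := hjB.trans hBN
  have hTσ : T * σ ≤ s := by linarith [mul_le_mul_of_nonneg_right hTN hσ0.le]
  have hTTσ : T ^ 2 * σ ≤ s := by
    have := mul_le_mul_of_nonneg_right (pow_le_pow_left₀ (by linarith) hTN 2) hσ0.le
    linarith
  have hTε : 1 ≤ T / ε := (le_div_iff₀ hε).2 (by linarith)
  set J := ⌈4 * (1 / P₁) * T * W / ε⌉₊ with hJ
  have hJlo : 4 * (1 / P₁) * T * W / ε ≤ J := Nat.le_ceil _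
  have hJup : (J : ℝ) ≤ (4 * W + 1) * (T / ε) := by
    have h1 := (Nat.ceil_lt_add_one (by positivity : 0 ≤ 4 * (1 / P₁) * T * W / ε)).le
    have h2 : 4 * (1 / P₁) * T * W / ε = 1 / P₁ * (4 * W * (T / ε)) := by ring
    have h3 := mul_le_mul_of_nonneg_right hη1 (by positivity : 0 ≤ 4 * W * (T / ε))
    linarith
  have hJT : J * T ≤ (4 * W + 1) * (T ^ 2 / ε) := by
    have h1 := mul_le_mul_of_nonneg_right hJup (by linarith : 0 ≤ T)
    have h2 : (4 * W + 1) * (T / ε) * T = (4 * W + 1) * (T ^ 2 / ε) := by ring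
    linarith
  have hησ : 1 / P₁ * σ ≤ σ := mul_le_of_le_one_left hσ0.le hη1
  refine ⟨j, J, ?_, hgrow, ?_, ?_, ?_, ?_⟩
  · rw [le_div_iff₀ (by positivity)]
    have h1 : T * (1 / P₁ * σ * A') * (64 * M) = (T * (64 * M * A')) * (1 / P₁ * σ) := by ring
    have h2 := mul_le_mul_of_nonneg_left hησ (by positivity : 0 ≤ T * (64 * M * A'))
    have h3 := mul_le_mul_of_nonneg_right hTσ (by positivity : 0 ≤ 64 * M * A')
    linarith
  · rw [one_div_mul_eq_div W, le_div_iff₀ hW0]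
    have h1 : T * (1 / P₁ * σ * K) * (4 * (1 / P₁) * T) * W =
        (T ^ 2 * σ * (4 * W * K)) * (1 / P₁ * (1 / P₁)) := by ring
    have h2 : 1 / P₁ * (1 / P₁) ≤ 1 := mul_le_one₀ hη1 hη0.le hη1
    have h3 := mul_le_mul_of_nonneg_left h2 (by positivity : 0 ≤ T ^ 2 * σ * (4 * W * K))
    have h4 := mul_le_mul_of_nonneg_right hTTσ hWK
    linarith
  · have h1 := mul_le_mul_of_nonneg_right hησ hK
    have h2 : (J * T) * (1 / P₁ * σ * K) ≤ (4 * W + 1) * (T ^ 2 / ε) * (σ * K) :=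
      mul_le_mul hJT h1 (by positivity) (by positivity)
    have h3 : (4 * W + 1) * (T ^ 2 / ε) * (σ * K) = T ^ 2 * σ * ((4 * W + 1) * K) / ε := by ring
    have h4 := mul_le_mul_of_nonneg_right hTTσ hWK1
    refine h2.trans ?_
    rw [h3, div_le_one hε]
    linarith
  · have h1 : J * (1 / W * ε) = J * ε / W := by ring
    rw [h1, le_div_iff₀ hW0, ← div_le_iff₀ hε]
    exact hJlo
  · have hℓsq : ℓ ^ 2 ≤ 4 / ε := by
      have h1 : ℓ / 2 ≤ Real.exp (ℓ / 2) := by linarith [Real.add_one_le_exp (ℓ / 2)]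
      have h2 := pow_le_pow_left₀ (by linarith) h1 2
      have h3 : Real.exp (ℓ / 2) ^ 2 = 1 / ε := by
        rw [← hexpℓ, ← Real.exp_nat_mul]; ring_nf
      rw [h3] at h2
      have : 4 / ε = 4 * (1 / ε) := by ring
      linarith
    have hTTN : T ^ 2 ≤ (B₁ * P) ^ 2 * (d ^ 2 * ℓ ^ 2 / ε ^ 2) := by
      refine (pow_le_pow_left₀ (by linarith) hTN 2).trans (le_of_eq ?_)
      rw [hN, hy]; ring
    have h1 : (J * T : ℝ) ≤ (4 * W + 1) * ((B₁ * P) ^ 2 * (d ^ 2 * ℓ ^ 2 / ε ^ 2) / ε) := by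
      refine hJT.trans ?_
      gcongr
    refine h1.trans ?_
    have h2 : (4 * W + 1) * ((B₁ * P) ^ 2 * (d ^ 2 * ℓ ^ 2 / ε ^ 2) / ε) =
        ((4 * W + 1) * (B₁ * P) ^ 2 * d ^ 2 / ε ^ 3) * ℓ ^ 2 := by field_simp
    have h3 : (d : ℝ) ^ 2 / ε ^ 4 * (4 * (4 * W + 1) * (B₁ * P) ^ 2) =
        ((4 * W + 1) * (B₁ * P) ^ 2 * d ^ 2 / ε ^ 3) * (4 / ε) := by field_simp
    rw [h2, h3]
    exact mul_le_mul_of_nonneg_left hℓsq (by positivity)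

/-! ### The polynomials -/

section Polynomials

variable {A : Type*} [CommRing A]

/-- The second moment bound `(L[ρ₀] + 1) / b_V + 1` as a polynomial in the problem parameters
`x = (k, M_V, M_R, b_V⁻¹, B_V, C_R, B_Φ, C_Φ, C_V, L[ρ₀])`.  This and the following polynomial
expressions are stated over any commutative ring, so that they can be read both as real numbers
and as formal polynomials. -/
def momentBound (x : Fin 10 → A) : A := (x 9 + 1) * x 3 + 1

/-- The Lipschitz constant `smoothness` of the gradients of the tilted potentials. -/
def gradientBound (x : Fin 10 → A) : A := x 0 * x 2 * x 7 + x 8 + 1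

/-- The inverse step size. -/
def stepInv (x : Fin 10 → A) : A :=
  4 * gradientBound x + 16 * x 5 * x 0 ^ 2 * x 7 ^ 2 * momentBound x + 1

/-- The factor of `η √D` in the change of the tilted potential during one step. -/
def driftBound (x : Fin 10 → A) : A := 2 * x 0 * x 7 * x 6 * x 5 * (momentBound x + 1)

/-- The factor of `η σ` in the change of the tilted potential during one step. -/
def noiseDrift (x : Fin 10 → A) : A := x 5 * x 6 ^ 2 * (momentBound x + 1)

/-- A bound for the objective at the uniform distribution on the sphere. -/
def noiseCost (x : Fin 10 → A) : A := x 9 + x 2 * x 6 * (momentBound x + 1) + x 4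

/-- The inverse of the constant `c` in `Landscape.gap_sq_le_sum_dissipation`. -/
def rateInv (x : Fin 10 → A) : A :=
  (64 * momentBound x) ^ 2 * driftBound x ^ 2 + 4 * momentBound x * stepInv x ^ 2 + 1

/-- The length of a window is at most `windowBound * noiseExponent * d log (1 / ε) / ε`. -/
def windowBound (x : Fin 10 → A) : A :=
  16 * momentBound x * stepInv x *
    (4 * momentBound x + 2 * stepInv x + 1024 * gradientBound x * momentBound x + 3) + 4

/-- The polynomial `p_σ` in the noise level. -/
def noiseExponent (x : Fin 10 → A) : A :=
  12 + 192 * (windowBound x ^ 2 * (4 + (4 * rateInv x + 1) * noiseCost x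
    + 128 * momentBound x * noiseDrift x + 4 * rateInv x * noiseCost x))

/-- The polynomial `p_t` in the number of steps. -/
def timeBound (x : Fin 10 → A) : A :=
  4 * (4 * rateInv x + 1) * (windowBound x * noiseExponent x) ^ 2

lemma eval_stepInv (x : Fin 10 → ℝ) :
    MvPolynomial.eval x (stepInv MvPolynomial.X) = stepInv x := by
  simp [stepInv, gradientBound, momentBound]

lemma eval_windowBound (x : Fin 10 → ℝ) :
    MvPolynomial.eval x (windowBound MvPolynomial.X) = windowBound x := by
  simp [windowBound, eval_stepInv, gradientBound, momentBound]

lemma eval_rateInv (x : Fin 10 → ℝ) :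
    MvPolynomial.eval x (rateInv MvPolynomial.X) = rateInv x := by
  simp [rateInv, eval_stepInv, driftBound, momentBound]

lemma eval_noiseExponent (x : Fin 10 → ℝ) :
    MvPolynomial.eval x (noiseExponent MvPolynomial.X) = noiseExponent x := by
  simp [noiseExponent, eval_windowBound, eval_rateInv, noiseCost, noiseDrift, momentBound]

lemma eval_timeBound (x : Fin 10 → ℝ) :
    MvPolynomial.eval x (timeBound MvPolynomial.X) = timeBound x := by
  simp [timeBound, eval_windowBound, eval_rateInv, eval_noiseExponent]

end Polynomials

end PerturbedWGF

end

/-! ### Convergence of the perturbed dynamics -/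

theorem mainTheorem8 :
    ∃ pσ pη pt : MvPolynomial (Fin 10) ℝ,
      ∀ (d k : ℕ), 1 ≤ d → 1 ≤ k →
      ∀ (R : PerturbedWGF.E k → ℝ) (Φ : PerturbedWGF.E (d + 1) → PerturbedWGF.E k)
        (V : PerturbedWGF.E (d + 1) → ℝ)
        (M_R C_R B_Φ M_Φ C_Φ b_V B_V M_V C_V : ℝ),
      PerturbedWGF.IsTwoHomogeneous Φ →
      PerturbedWGF.IsTwoHomogeneous V →
      PerturbedWGF.RegularLoss R M_R C_R →
      PerturbedWGF.RegularFeature Φ B_Φ M_Φ →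
      PerturbedWGF.RegularPotential V b_V B_V M_V →
      (∀ i : Fin k, PerturbedWGF.GradientLipschitz (fun θ => Φ θ i) C_Φ) →
      PerturbedWGF.GradientLipschitz V C_V →
      ∀ (ρ₀ : Measure (PerturbedWGF.E (d + 1))), PerturbedWGF.IsAdmissible ρ₀ →
      ∀ (ε : ℝ), 0 < ε → ε ≤ 1 / 2 →
      ∀ (X : Fin 10 → ℝ),
      X = ![(k : ℝ), M_V, M_R, b_V⁻¹, B_V, C_R, B_Φ, C_Φ, C_V,
        PerturbedWGF.objective R Φ V ρ₀] →
      ∀ (σ η tε : ℝ),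
      σ = Real.exp (-((d : ℝ) * Real.log (1 / ε) * MvPolynomial.eval X pσ)) →
      η = 1 / MvPolynomial.eval X pη →
      tε = (d : ℝ) ^ 2 / ε ^ 4 * MvPolynomial.eval X pt →
      0 < MvPolynomial.eval X pσ ∧ 0 < η ∧ η ≤ 1 ∧
      (∀ t : ℕ, PerturbedWGF.IsAdmissible (PerturbedWGF.discreteFlow R Φ V η σ ρ₀ t)) ∧
      ∃ t : ℕ, (t : ℝ) ≤ tε ∧
        PerturbedWGF.objective R Φ V (PerturbedWGF.discreteFlow R Φ V η σ ρ₀ t)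
          - PerturbedWGF.optimalValue R Φ V ≤ ε := by
  refine ⟨PerturbedWGF.noiseExponent MvPolynomial.X, PerturbedWGF.stepInv MvPolynomial.X,
    PerturbedWGF.timeBound MvPolynomial.X, ?_⟩
  intro d k hd hk R Φ V M_R C_R B_Φ M_Φ C_Φ b_V B_V M_V C_V homΦ homV loss feat pot gradΦ gradV
    ρ₀ hρ₀ ε hε hε2 X hX σ η tε hσ hη htε
  rw [PerturbedWGF.eval_noiseExponent] at hσ ⊢
  rw [PerturbedWGF.eval_stepInv] at hη
  rw [PerturbedWGF.eval_timeBound] at htε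
  have h : PerturbedWGF.Landscape R Φ V M_R C_R B_Φ C_Φ b_V B_V C_V :=
    ⟨Nat.succ_pos d, hk, homΦ, homV, loss, feat.differentiable, feat.norm_le, pot.differentiable,
      pot.lower_pos, pot.lower_le, pot.le_upper, gradΦ, gradV⟩
  have hL₀ := h.objective_nonneg hρ₀
  have hH := h.smoothness_pos
  have hB := h.B_Φ_nonneg
  have hBV := h.B_V_nonneg
  have hC := h.C_Φ_nonneg
  have hMR := loss.M_nonneg
  have hCR := loss.C_nonneg
  have hbinv : 0 < b_V⁻¹ := inv_pos.2 h.b_pos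
  -- The constants are introduced as plain real variables, each with its expression in terms of the
  -- preceding ones, which keeps the nested polynomials folded.
  obtain ⟨L₀, hL₀def⟩ : ∃ L₀, L₀ = PerturbedWGF.objective R Φ V ρ₀ := ⟨_, rfl⟩
  rw [← hL₀def] at hX hL₀
  obtain ⟨M, hM⟩ : ∃ M, M = PerturbedWGF.momentBound X := ⟨_, rfl⟩
  have hM' : M = (L₀ + 1) * b_V⁻¹ + 1 := by rw [hM, hX]; rfl
  have hM1 : 1 ≤ M := by rw [hM']; linarith [mul_nonneg (by linarith : 0 ≤ L₀ + 1) hbinv.le]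
  have hM0 : 0 < M := by linarith
  have hgrad : PerturbedWGF.gradientBound X = PerturbedWGF.smoothness k M_R C_Φ C_V := by
    rw [hX]; rfl
  set H := PerturbedWGF.smoothness k M_R C_Φ C_V with hHdef
  obtain ⟨P₁, hP₁⟩ : ∃ P₁, P₁ = PerturbedWGF.stepInv X := ⟨_, rfl⟩
  have hP₁' : P₁ = 4 * H + 16 * C_R * k ^ 2 * C_Φ ^ 2 * M + 1 := by
    rw [hP₁, PerturbedWGF.stepInv, hgrad, ← hM, hX]; rfl
  have hquad : 0 ≤ 16 * C_R * k ^ 2 * C_Φ ^ 2 * M := by positivity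
  have hP₁1 : 1 ≤ P₁ := by rw [hP₁']; linarith
  have hP₁0 : 0 < P₁ := by linarith
  obtain ⟨A, hA⟩ : ∃ A, A = PerturbedWGF.driftBound X := ⟨_, rfl⟩
  have hA' : A = 2 * k * C_Φ * B_Φ * C_R * (M + 1) := by
    rw [hA, PerturbedWGF.driftBound, ← hM, hX]; rfl
  obtain ⟨D, hD⟩ : ∃ D, D = PerturbedWGF.noiseDrift X := ⟨_, rfl⟩
  have hD' : D = C_R * B_Φ ^ 2 * (M + 1) := by
    rw [hD, PerturbedWGF.noiseDrift, ← hM, hX]; rfl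
  have hD0 : 0 ≤ D := by rw [hD']; positivity
  obtain ⟨K, hK⟩ : ∃ K, K = PerturbedWGF.noiseCost X := ⟨_, rfl⟩
  have hK' : K = L₀ + M_R * B_Φ * (M + 1) + B_V := by
    rw [hK, PerturbedWGF.noiseCost, ← hM, hX]; rfl
  have hK0 : 0 ≤ K := by rw [hK']; positivity
  obtain ⟨W, hW⟩ : ∃ W, W = PerturbedWGF.rateInv X := ⟨_, rfl⟩
  have hW' : W = (64 * M) ^ 2 * A ^ 2 + 4 * M * P₁ ^ 2 + 1 := by
    rw [hW, PerturbedWGF.rateInv, ← hM, ← hA, ← hP₁]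
  have hW1 : 1 ≤ W := by
    rw [hW']; linarith [(by positivity : 0 ≤ (64 * M) ^ 2 * A ^ 2 + 4 * M * P₁ ^ 2)]
  have hW0 : 0 < W := by linarith
  obtain ⟨B₁, hB₁⟩ : ∃ B₁, B₁ = PerturbedWGF.windowBound X := ⟨_, rfl⟩
  have hB₁' : B₁ = 16 * M * P₁ * (4 * M + 2 * P₁ + 1024 * H * M + 3) + 4 := by
    rw [hB₁, PerturbedWGF.windowBound, hgrad, ← hM, ← hP₁]
  obtain ⟨P, hP⟩ : ∃ P, P = PerturbedWGF.noiseExponent X := ⟨_, rfl⟩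
  have hP' : P = 12 + 192 * (B₁ ^ 2 * (4 + (4 * W + 1) * K + 128 * M * D + 4 * W * K)) := by
    rw [hP, PerturbedWGF.noiseExponent, ← hB₁, ← hW, ← hK, ← hM, ← hD]
  have hP0 : 0 < P := by rw [hP']; positivity
  have ht' : PerturbedWGF.timeBound X = 4 * (4 * W + 1) * (B₁ * P) ^ 2 := by
    rw [PerturbedWGF.timeBound, ← hW, ← hB₁, ← hP]
  rw [← hP] at hσ ⊢
  rw [← hP₁] at hη
  rw [ht'] at htε
  have hη0 : 0 < η := by rw [hη]; positivity
  have hη1 : η ≤ 1 := by rw [hη, div_le_one hP₁0]; exact hP₁1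
  have hσ0 : 0 < σ := hσ ▸ Real.exp_pos _
  have hσ1 : σ ≤ 1 := by
    rw [hσ, Real.exp_le_one_iff, neg_nonpos]
    have : 0 ≤ Real.log (1 / ε) := Real.log_nonneg ((le_div_iff₀ hε).2 (by linarith))
    positivity
  have hp0 : 0 ≤ η * σ := by positivity
  have hp1 : η * σ ≤ 1 := mul_le_one₀ hη1 hσ0.le hσ1
  refine ⟨hP0, hη0, hη1, ?_, ?_⟩
  · intro t
    induction t with
    | zero => exact hρ₀
    | succ t ih => exact h.isAdmissible_discreteStep ih hp0 hp1
  have hMb : PerturbedWGF.objective R Φ V ρ₀ + 1 ≤ b_V * M := by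
    have h1 : b_V * M = L₀ + 1 + b_V := by
      rw [hM', mul_add, mul_left_comm, mul_inv_cancel₀ h.b_pos.ne']; ring
    rw [h1, ← hL₀def]
    linarith [h.b_pos]
  have hKU : PerturbedWGF.objective R Φ V (PerturbedWGF.uniformSphere (d + 1)) ≤ K := by
    rw [hK', hL₀def]
    exact h.objective_uniformSphere_le hρ₀
      (h.secondMoment_le_of_objective_le hρ₀ (by linarith))
  obtain ⟨j, J, hnoise, hgrow, hwindow, htotal, hJ, htime⟩ :=
    PerturbedWGF.exists_schedule hd hε hε2 hM1 hH hP₁1 hK0 hW1 hD0 hB₁' hP' hσ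
  rw [← hη] at hnoise hgrow hwindow htotal hJ
  obtain ⟨t, ht, hgap⟩ := h.exists_near_optimal hρ₀ hη0 hσ0.le hp1
    (by rw [hη, one_div_mul_eq_div, div_le_one hP₁0]; linarith) hM0 hMb
    (by rw [hη, one_div_mul_eq_div, div_le_one hP₁0]; linarith) hε hA' hD' (c := 1 / W)
    (by positivity) hKU
    (by
      rw [one_div_mul_eq_div, div_le_one hW0, hW']
      linarith [(by positivity : 0 ≤ 4 * M * P₁ ^ 2)])
    (by
      rw [hη, one_div_mul_eq_div, one_div, inv_pow, ← one_div,
        div_le_div_iff₀ hW0 (by positivity), hW']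
      linarith [sq_nonneg (64 * M * A)])
    hnoise hgrow hwindow htotal hJ
  refine ⟨t, ?_, hgap⟩
  rw [htε]
  refine le_trans ?_ htime
  exact_mod_cast ht
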